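/- Let $r_0$ be the $1$-periodic function on $\mathbb{R}$ with $r_0=1$ on $[0,\tfrac12)$ and $r_0=-1$ on $[\tfrac12,1)$, let $r_i(x)=r_0(2^i x)$ for $i\ge 0$, and for an integer $m=\sum_{i\ge 0}k_i2^i$ with $k_i\in\{0,1\}$ let $W_m=\prod_{i:\,k_i=1}r_i$ be the $m$-th Walsh function. Let $q>1$ and let $(m_k)_{k\ge1}$ be a sequence of positive integers with $m_{k+1}/m_k\ge q$ for all $k\ge 1$. Let $(a_{k,n})_{1\le k\le n}$ be a triangular array of real numbers and put $$S_n^{W}(x)=\sum_{k=1}^n a_{k,n}W_{m_k}(x)\quad(0\le x\le 1),\qquad A_n=\Big(\sum_{k=1}^n a_{k,n}^2\Big)^{1/2},\qquad d_n=\max_{1\le k\le n}|a_{k,n}| .$$ Suppose that $A_n\to\infty$ as $n\to\infty$, and moreover that * if $q\ge 2$: $\sum_{k=1}^n a_{k,n}^4\to\kappa_4<\infty$ and $n\,d_n^5\to 0$; * if $1<q<2$: there is $\varepsilon>0$ with $n^{1+\varepsilon}d_n^3\to 0$. For real $y$ let $\psi(y)=e^{-\kappa_4y^4/12}$ if $q\ge2$,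 and $\psi(y)=1$ if $1<q<2$. Write $|\cdot|$ for Lebesgue measure. Then, as $n\to\infty$: 1. (Extended central limit theorem.) For every real sequence $(y_n)$ with $y_n=o(A_n)$, $$\Big|\Big\{x\in[0,1]:\tfrac{S_n^{W}(x)}{A_n}\ge y_n\Big\}\Big|=(1+o(1))\,\frac1{\sqrt{2\pi}}\int_{y_n}^\infty e^{-u^2/2}\,du ,$$ and if in addition $y_n\to+\infty$, then this measure also equals $\dfrac{e^{-y_n^2/2}}{y_n\sqrt{2\pi}}\,(1+o(1))$. 2. (Moderate deviations.) For every fixed $y>0$, $$\big|\{x\in[0,1]:S_n^{W}(x)\ge A_n^2y\}\big|=\frac{e^{-A_n^2y^2/2}}{yA_n\sqrt{2\pi}}\,\psi(y)\,(1+o(1)),$$ and for every fixed $y<0$, $$\big|\{x\in[0,1]:S_n^{W}(x)\le A_n^2y\}\big|=\frac{e^{-A_n^2y^2/2}}{|y|A_n\sqrt{2\pi}}\,\psi(y)\,(1+o(1)).$$ -/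

import Mathlib

open Filter Topology MeasureTheory Asymptotics

noncomputable section

namespace LacunaryWalsh

/-- The function equal to `1` on `[0, 1/2)` and to `-1` on `[1/2, 1)`, extended to the real line
with period `1`. -/
def rademacherZero (x : ℝ) : ℝ := if Int.fract x < 1 / 2 then 1 else -1

/-- The Rademacher functions `r_n(x) = r_0(2^n x)`. -/
def rademacher (n : ℕ) (x : ℝ) : ℝ := rademacherZero (2 ^ n * x)

/-- The `n`-th Walsh function: the product of the `r_i` over all `i` such that the binary digit
of `n` at `2^i` is `1` (every such `i` satisfies `i < n`). -/
def walsh (n : ℕ) (x : ℝ) : ℝ := ∏ i ∈ Finset.range n with n.testBit i, rademacher i x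

/-- The sequence `m 1 < m 2 < ...` of positive integers has all ratios
`m (k + 1) / m k` at least `q`, where `q > 1`. -/
def IsLacunary (q : ℝ) (m : ℕ → ℕ) : Prop :=
  1 < q ∧ ∀ k : ℕ, 1 ≤ k → 0 < m k ∧ q ≤ (m (k + 1) : ℝ) / (m k : ℝ)

/-- The partial sum `S_n(x) = ∑_{k=1}^n a_{k,n} W_{m_k}(x)`; `a k n` stands for `a_{k,n}`. -/
def walshSum (a : ℕ → ℕ → ℝ) (m : ℕ → ℕ) (n : ℕ) (x : ℝ) : ℝ :=
  ∑ k ∈ Finset.Icc 1 n, a k n * walsh (m k) x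

/-- `A_n = (∑_{k=1}^n a_{k,n}^2)^{1/2}`. -/
def rowNorm (a : ℕ → ℕ → ℝ) (n : ℕ) : ℝ := √(∑ k ∈ Finset.Icc 1 n, a k n ^ 2)

/-- `d_n = max_{1 ≤ k ≤ n} |a_{k,n}|` (and `0` for `n = 0`). -/
def rowMax (a : ℕ → ℕ → ℝ) (n : ℕ) : ℝ := ((Finset.Icc 1 n).sup fun k => ‖a k n‖₊ : NNReal)

/-- The limiting function `ψ`, on the real line: `exp (-κ₄ y^4 / 12)` if `q ≥ 2`, and `1`
if `1 < q < 2`. -/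
def limitFun (q κ₄ y : ℝ) : ℝ := if 2 ≤ q then Real.exp (-(y ^ 4 / 12) * κ₄) else 1

end LacunaryWalsh

end

namespace LacunaryWalsh

/-! The core is mod-Gaussian convergence: locally uniformly in complex `z`, `E exp(z S_n) = exp(A_n²
z²/2 - κ z⁴/12) (1 + o(1))`, with `κ = κ₄` if `q ≥ 2` and `κ = 0` if `q < 2`. All the tail estimates
follow from this.

Since a Walsh function is `±1`, `exp(z b W) = cosh(z b) (1 + tanh(z b) W)`. The product of the
`cosh` factors gives the Gaussian and quartic terms, because `log cosh w = w²/2 - w⁴/12 + ...`. As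
`W_a W_b = W_{a xor b}`, the integral of the remaining Riesz product is a weighted count of the
relations `m_{k_1} xor ... xor m_{k_l} = 0` (`integral_walsh_mul_prod`). If `q ≥ 2`, the `m_k` have
distinct leading bits and only the empty relation exists (`xorSum_zero_eq_one`). If `q < 2`, the
largest member of a relation leaves boundedly many choices for the next two, so the count is at most
`exp(K n d³)`, with `d` a bound for the weights (`xorSum_zero_le`).

For the tail at `A_n² h`, tilt the law by `exp(h x)`. The probability becomes `M(h) exp(-(h A_n)²)`
times the integral of `exp(-v)` over `v ≥ 0` under a centred law that is nearly Gaussian with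
standard deviation `h A_n`; a local limit theorem evaluates that integral as `1/(h A_n √(2π))`
asymptotically (`GaussianCharFun.tendsto_integral_exp_neg`, `IsModGaussian.tendsto_tail`). Constant
`h = y` gives moderate deviations, and `h = y_n/A_n` gives the extended central limit theorem when
`y_n → ∞`. Lévy's theorem and Chernoff's bound cover convergent `y_n` and `y_n → -∞`, and a
subsequence argument joins the three cases (`IsModGaussian.tendsto_ratio`). -/

/-! ### Walsh functions: group law and mean values -/

theorem rademacherZero_mul_self (x : ℝ) : rademacherZero x * rademacherZero x = 1 := by
  unfold rademacherZero; split_ifs <;> norm_num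

theorem rademacherZero_add_int (x : ℝ) (k : ℤ) :
    rademacherZero (x + k) = rademacherZero x := by
  simp [rademacherZero]

theorem rademacherZero_add_half (x : ℝ) :
    rademacherZero (x + 1 / 2) = -rademacherZero x := by
  have h0 := Int.fract_nonneg x
  have h1 := Int.fract_lt_one x
  have hx : x + 1 / 2 = (Int.fract x + 1 / 2) + (⌊x⌋ : ℤ) := by
    have := Int.fract_add_floor x; linarith
  rw [hx, rademacherZero_add_int]
  unfold rademacherZero
  by_cases h : Int.fract x < 1 / 2
  · have : Int.fract (Int.fract x + 1 / 2) = Int.fract x + 1 / 2 :=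
      Int.fract_eq_self.2 ⟨by linarith, by linarith⟩
    rw [this, if_pos h, if_neg (by linarith)]
  · have : Int.fract (Int.fract x + 1 / 2) = Int.fract x - 1 / 2 := by
      rw [Int.fract_eq_iff]
      exact ⟨by linarith, by linarith, 1, by push_cast; ring⟩
    rw [this, if_neg h, if_pos (by linarith)]; ring

theorem measurable_rademacher (i : ℕ) : Measurable (rademacher i) := by
  unfold rademacher rademacherZero
  exact Measurable.ite (measurableSet_lt (by fun_prop) (by fun_prop)) (by fun_prop) (by fun_prop)

theorem measurable_walsh (n : ℕ) : Measurable (walsh n) := by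
  unfold walsh
  exact Finset.measurable_prod _ fun i _ => measurable_rademacher i

theorem walsh_eq_prod_range (n N : ℕ) (h : n ≤ N) (x : ℝ) :
    walsh n x = ∏ i ∈ Finset.range N, if n.testBit i then rademacher i x else 1 := by
  rw [walsh, Finset.prod_filter]
  refine Finset.prod_subset (by simpa using h) fun i _ hi => ?_
  rw [if_neg]
  have : n < 2 ^ i := by
    have h1 : n ≤ i := by simpa using hi
    exact h1.trans_lt Nat.lt_two_pow_self
  simp [Nat.testBit_lt_two_pow this]

theorem walsh_zero (x : ℝ) : walsh 0 x = 1 := by simp [walsh]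

theorem walsh_mul_walsh (a b : ℕ) (x : ℝ) : walsh a x * walsh b x = walsh (a ^^^ b) x := by
  set N := max (max a b) (a ^^^ b)
  rw [walsh_eq_prod_range a N (by simp [N]), walsh_eq_prod_range b N (by simp [N]),
    walsh_eq_prod_range (a ^^^ b) N (by simp [N]), ← Finset.prod_mul_distrib]
  refine Finset.prod_congr rfl fun i _ => ?_
  have := rademacherZero_mul_self (2 ^ i * x)
  rw [Nat.testBit_xor]
  cases a.testBit i <;> cases b.testBit i <;> simp [rademacher, this]

theorem walsh_eq_one_or (n : ℕ) (x : ℝ) : walsh n x = 1 ∨ walsh n x = -1 := by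
  have h := walsh_mul_walsh n n x
  rw [Nat.xor_self, walsh_zero] at h
  exact mul_self_eq_one_iff.1 h

theorem abs_walsh (n : ℕ) (x : ℝ) : |walsh n x| = 1 := by
  rcases walsh_eq_one_or n x with h | h <;> simp [h]

theorem walsh_add_one (n : ℕ) (x : ℝ) : walsh n (x + 1) = walsh n x := by
  unfold walsh
  refine Finset.prod_congr rfl fun i _ => ?_
  have := rademacherZero_add_int (2 ^ i * x) (2 ^ i)
  simp only [rademacher]
  rw [← this]; push_cast; ring_nf

/-- With `i` the lowest set bit, the shift moves `r_i` by half a period and every later `r_j` by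
whole periods, so exactly one factor changes sign. -/
theorem walsh_add_half_pow (n i : ℕ) (hi : n.testBit i = true)
    (hlt : ∀ j < i, n.testBit j = false) (x : ℝ) :
    walsh n (x + (2 ^ (i + 1))⁻¹) = -walsh n x := by
  have hmem : i ∈ (Finset.range n).filter fun i => n.testBit i := by
    simp only [Finset.mem_filter, Finset.mem_range, hi, and_true]
    by_contra h
    have : n < 2 ^ i := (not_lt.1 h).trans_lt Nat.lt_two_pow_self
    simp [Nat.testBit_lt_two_pow this] at hi
  rw [walsh, walsh, ← Finset.mul_prod_erase _ _ hmem, ← Finset.mul_prod_erase _ _ hmem,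
    ← neg_mul]
  congr 1
  · have := rademacherZero_add_half (2 ^ i * x)
    simp only [rademacher]
    rw [← this]; congr 1; rw [pow_succ]; field_simp
  · refine Finset.prod_congr rfl fun j hj => ?_
    simp only [Finset.mem_erase, Finset.mem_filter] at hj
    have hij : i < j := by
      rcases lt_trichotomy i j with h | h | h
      · exact h
      · exact absurd h.symm hj.1
      · simp [hlt j h] at hj
    have := rademacherZero_add_int (2 ^ j * x) (2 ^ (j - (i + 1)))
    simp only [rademacher]
    rw [← this]; congr 1; push_cast
    have h2 : (2 : ℝ) ^ j = 2 ^ (j - (i + 1)) * 2 ^ (i + 1) := by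
      rw [← pow_add]; congr 1; omega
    rw [mul_add, h2]; field_simp

/-- Lebesgue measure on the unit interval. -/
noncomputable def unitMeasure : Measure ℝ := volume.restrict (Set.Icc 0 1)

instance : IsProbabilityMeasure unitMeasure := by
  constructor; simp [unitMeasure]

theorem integral_walsh (n : ℕ) : ∫ x, walsh n x ∂unitMeasure = if n = 0 then 1 else 0 := by
  split_ifs with h
  · subst h; simp [walsh_zero]
  · have hex : ∃ i, n.testBit i = true := Nat.exists_testBit_of_ne_zero h
    classical
    have h1 := Nat.find_spec hex
    have h2 : ∀ j < Nat.find hex, n.testBit j = false := fun j hj => by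
      simpa using Nat.find_min hex hj
    have key := walsh_add_half_pow n _ h1 h2
    set δ : ℝ := (2 ^ (Nat.find hex + 1))⁻¹
    rw [unitMeasure, integral_Icc_eq_integral_Ioc, ← intervalIntegral.integral_of_le zero_le_one]
    have hper : Function.Periodic (walsh n) 1 := walsh_add_one n
    have e1 := hper.intervalIntegral_add_eq 0 δ
    have e2 := intervalIntegral.integral_comp_add_right (a := 0) (b := 1) (walsh n) δ
    simp only [key, intervalIntegral.integral_neg] at e2
    rw [zero_add, add_comm δ 1] at e1
    rw [zero_add, ← e1] at e2
    linarith

/-! ### Riesz products and weighted counts of xor relations -/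

/-- The sum of the products `∏_{k ∈ B} t k` over the sets `B` of indices `k < N` for which the
exclusive or of the numbers `m k`, `k ∈ B`, is `u`. -/
def xorSum {R : Type*} [Semiring R] (m : ℕ → ℕ) (t : ℕ → R) : ℕ → ℕ → R
  | 0, u => if u = 0 then 1 else 0
  | N + 1, u => xorSum m t N u + t N * xorSum m t N (u ^^^ m N)

theorem integrable_walsh_mul_prod {𝕜 : Type*} [RCLike 𝕜] (m : ℕ → ℕ) (t : ℕ → 𝕜) (N u : ℕ) :
    Integrable (fun x => (walsh u x : 𝕜) * ∏ k ∈ Finset.range N, (1 + t k * (walsh (m k) x : 𝕜)))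
      unitMeasure := by
  refine Integrable.of_bound (C := ∏ k ∈ Finset.range N, (1 + ‖t k‖)) ?_
    (Eventually.of_forall fun x => ?_)
  · refine Measurable.aestronglyMeasurable ?_
    have h := measurable_walsh
    have h' : ∀ n, Measurable fun x => ((walsh n x : ℝ) : 𝕜) := fun n =>
      RCLike.measurable_ofReal.comp (h n)
    refine (h' u).mul (Finset.measurable_prod _ fun k _ => ?_)
    exact measurable_const.add (measurable_const.mul (h' _))
  · rw [norm_mul, norm_prod, RCLike.norm_ofReal, abs_walsh, one_mul]
    refine Finset.prod_le_prod (fun _ _ => norm_nonneg _) fun k _ => ?_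
    refine (norm_add_le _ _).trans ?_
    rw [norm_mul, RCLike.norm_ofReal, abs_walsh]
    simp

theorem integral_walsh_mul_prod {𝕜 : Type*} [RCLike 𝕜] (m : ℕ → ℕ) (t : ℕ → 𝕜) (N u : ℕ) :
    ∫ x, (walsh u x : 𝕜) * ∏ k ∈ Finset.range N, (1 + t k * (walsh (m k) x : 𝕜)) ∂unitMeasure
      = xorSum m t N u := by
  induction N generalizing u with
  | zero =>
    simp only [Finset.range_zero, Finset.prod_empty, mul_one, xorSum]
    rw [integral_ofReal, integral_walsh]
    split_ifs <;> simp
  | succ N ih =>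
    rw [xorSum, ← ih, ← ih, ← integral_const_mul,
      ← integral_add (integrable_walsh_mul_prod m t N u)
        ((integrable_walsh_mul_prod m t N _).const_mul _)]
    congr 1; ext x
    rw [Finset.prod_range_succ, ← walsh_mul_walsh]
    push_cast
    ring

/-- The subtracted indicator is the contribution of the empty set; the triangle inequality applies
to all the others. -/
theorem norm_xorSum_sub_le {R : Type*} [NormedRing R] (m : ℕ → ℕ) (t : ℕ → R) (N u : ℕ) :
    ‖xorSum m t N u - (if u = 0 then 1 else 0)‖
      ≤ xorSum m (fun k => ‖t k‖) N u - (if u = 0 then 1 else 0) := by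
  induction N generalizing u with
  | zero => simp [xorSum]
  | succ N ih =>
    have h1 := ih u
    have h2 := ih (u ^^^ m N)
    simp only [xorSum]
    have e : xorSum m t N u + t N * xorSum m t N (u ^^^ m N) - (if u = 0 then 1 else 0)
        = (xorSum m t N u - (if u = 0 then 1 else 0))
          + t N * (xorSum m t N (u ^^^ m N) - (if u ^^^ m N = 0 then 1 else 0))
          + t N * (if u ^^^ m N = 0 then 1 else 0) := by noncomm_ring
    rw [e]
    have h3 : ‖t N * (if u ^^^ m N = 0 then 1 else 0)‖ ≤ ‖t N‖ * (if u ^^^ m N = 0 then 1 else 0) := by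
      split_ifs <;> simp
    have h4 := (norm_mul_le (t N)
      (xorSum m t N (u ^^^ m N) - (if u ^^^ m N = 0 then 1 else 0))).trans
        (mul_le_mul_of_nonneg_left h2 (norm_nonneg _))
    refine (norm_add₃_le).trans ?_
    linarith

section Bounds

variable {m : ℕ → ℕ} {x : ℕ → ℝ}

theorem xorSum_nonneg (hx : ∀ k, 0 ≤ x k) (N u : ℕ) : 0 ≤ xorSum m x N u := by
  induction N generalizing u with
  | zero => simp only [xorSum]; split_ifs <;> norm_num
  | succ N ih => exact add_nonneg (ih _) (mul_nonneg (hx _) (ih _))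

theorem xorSum_mono (hx : ∀ k, 0 ≤ x k) (u : ℕ) : Monotone fun N => xorSum m x N u :=
  monotone_nat_of_le_succ fun _ =>
    le_add_of_nonneg_right (mul_nonneg (hx _) (xorSum_nonneg hx _ _))

/-- For weights in `[0, 1]` the Riesz product is nonnegative, so replacing `W_u` by `1` can only
increase the integral. -/
theorem xorSum_le_zero (hx : ∀ k, 0 ≤ x k) (hx1 : ∀ k, x k ≤ 1) (N u : ℕ) :
    xorSum m x N u ≤ xorSum m x N 0 := by
  rw [← integral_walsh_mul_prod (𝕜 := ℝ), ← integral_walsh_mul_prod (𝕜 := ℝ)]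
  refine integral_mono (integrable_walsh_mul_prod m x N u) (integrable_walsh_mul_prod m x N 0)
    fun y => ?_
  refine mul_le_mul_of_nonneg_right ?_ (Finset.prod_nonneg fun k _ => ?_)
  · rw [walsh_zero]; rcases walsh_eq_one_or u y with h | h <;> simp [h]
  · have := hx k
    have := hx1 k
    rcases walsh_eq_one_or (m k) y with h | h <;> simp [h] <;> linarith

/-- Xor with a number below `2 ^ j` leaves the bits from position `j` upwards unchanged. -/
theorem two_pow_le_xor {a b j : ℕ} (ha : 2 ^ j ≤ a) (hb : b < 2 ^ j) : 2 ^ j ≤ a ^^^ b := by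
  by_contra! h
  have h1 := Nat.xor_lt_two_pow h hb
  rw [Nat.xor_assoc, Nat.xor_self, Nat.xor_zero] at h1
  omega

/-- A triangle inequality, from `c xor d ≤ c + d` (addition without carries). It bounds below the
xor of two well separated numbers. -/
theorem le_add_xor (a b : ℕ) : a ≤ b + (a ^^^ b) := by
  have h : a = b ^^^ (a ^^^ b) := by
    rw [Nat.xor_comm a b, ← Nat.xor_assoc, Nat.xor_self, Nat.zero_xor]
  have h2 : ∀ c d : ℕ, c ^^^ d ≤ c + d := fun c d => by
    induction c using Nat.strong_induction_on generalizing d with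
    | _ c ih =>
      rcases Nat.eq_zero_or_pos c with rfl | hc
      · simp
      · have h1 := ih (c / 2) (by omega) (d / 2)
        rw [← Nat.xor_div_two] at h1
        have h3 : (c ^^^ d) % 2 = (c + d) % 2 := by
          rw [Nat.xor_mod_two_eq]
        omega
  calc a = b ^^^ (a ^^^ b) := h
    _ ≤ _ := h2 _ _

theorem xorSum_eq_zero {N u j : ℕ} (hm : ∀ k < N, m k < 2 ^ j) (hu : 2 ^ j ≤ u) :
    xorSum m x N u = 0 := by
  induction N generalizing u with
  | zero =>
    have : 0 < 2 ^ j := by positivity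
    simp [xorSum]; omega
  | succ N ih =>
    have h := fun k (hk : k < N) => hm k (hk.trans (Nat.lt_succ_self _))
    rw [xorSum, ih h hu, ih h (two_pow_le_xor hu (hm N (Nat.lt_succ_self _)))]
    simp

/-- Sort the index sets by their largest index `k`. If `2 * m k ≤ v`, every member of the set lies
below the leading bit of `v`, so the xor cannot be `v`. -/
theorem xorSum_le_sum (hmono : StrictMono m) {v : ℕ} (hv : 0 < v) (N : ℕ) :
    xorSum m x N v
      ≤ ∑ k ∈ Finset.range N with v < 2 * m k, x k * xorSum m x k (v ^^^ m k) := by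
  induction N with
  | zero => simp [xorSum, hv.ne']
  | succ N ih =>
    rw [Finset.range_add_one, Finset.filter_insert, xorSum]
    split_ifs with h
    · rw [Finset.sum_insert (by simp)]; linarith
    · have h1 : 2 ^ Nat.log 2 v ≤ v := Nat.pow_log_le_self 2 hv.ne'
      have h2 : v < 2 ^ (Nat.log 2 v + 1) := Nat.lt_pow_succ_log_self (by norm_num) v
      have h3 : m N < 2 ^ Nat.log 2 v := by rw [pow_succ] at h2; omega
      rw [xorSum_eq_zero (fun k hk => (hmono hk).trans h3) (two_pow_le_xor h1 h3)]
      simpa using ih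

end Bounds

/-! ### Scarcity of relations in a lacunary sequence -/

section Lacunary

variable {m : ℕ → ℕ} {x : ℕ → ℝ} {q : ℝ}

theorem pow_mul_le (hq : 1 < q) (hr : ∀ k, q * m k ≤ m (k + 1)) (k i : ℕ) :
    q ^ i * m k ≤ m (k + i) := by
  induction i with
  | zero => simp
  | succ i ih =>
    calc q ^ (i + 1) * m k = q * (q ^ i * m k) := by ring
      _ ≤ q * m (k + i) := by gcongr
      _ ≤ _ := hr _

theorem strictMono_of_ratio (hq : 1 < q) (h0 : ∀ k, 0 < m k) (hr : ∀ k, q * m k ≤ m (k + 1)) :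
    StrictMono m := by
  refine strictMono_nat_of_lt_succ fun k => ?_
  have h1 : (0 : ℝ) < m k := by exact_mod_cast h0 k
  have h2 := hr k
  have : (m k : ℝ) < m (k + 1) := by nlinarith
  exact_mod_cast this

/-- If `k < N - C`, then `v ≥ δ * m N ≥ δ * q ^ C * m k ≥ 2 * m k`; hence only the last `C` indices
before `N` can qualify. -/
theorem card_filter_le (hq : 1 < q) (h0 : ∀ k, 0 < m k) (hr : ∀ k, q * m k ≤ m (k + 1))
    {δ : ℝ} {C : ℕ} (hC : 2 ≤ q ^ C * δ) {N N' v : ℕ} (hN : N' ≤ N) (hv : δ * m N ≤ v) :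
    ((Finset.range N').filter fun k => v < 2 * m k).card ≤ C := by
  have hsub : ((Finset.range N').filter fun k => v < 2 * m k) ⊆ Finset.Ico (N - C) N := by
    intro k hk
    simp only [Finset.mem_filter, Finset.mem_range] at hk
    rw [Finset.mem_Ico]
    refine ⟨?_, hk.1.trans_le hN⟩
    by_contra! hlt
    have h1 := pow_mul_le hq hr k (N - k)
    rw [show k + (N - k) = N by omega] at h1
    have h2 : q ^ C ≤ q ^ (N - k) := pow_le_pow_right₀ hq.le (by omega)
    have h3 : (v : ℝ) < 2 * m k := by exact_mod_cast hk.2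
    have h4 : (0 : ℝ) < m k := by exact_mod_cast h0 k
    have hδ : 0 < δ := by
      by_contra! hd
      have : q ^ C * δ ≤ 0 := mul_nonpos_of_nonneg_of_nonpos (by positivity) hd
      linarith
    have h5 : q ^ C * m k ≤ m N := le_trans (by gcongr) h1
    nlinarith
  refine (Finset.card_le_card hsub).trans ?_
  rw [Nat.card_Ico]; omega

/-- Peels off the largest member of a representation of `v`: at most `C` choices, each of weight at
most `d`. -/
theorem xorSum_le_of_lacunary (hq : 1 < q) (h0 : ∀ k, 0 < m k) (hr : ∀ k, q * m k ≤ m (k + 1))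
    {δ : ℝ} {C : ℕ} (hC : 2 ≤ q ^ C * δ) {N N' v : ℕ} (hN : N' ≤ N) (hv : δ * m N ≤ v)
    (hv0 : 0 < v) (hx : ∀ k, 0 ≤ x k) {d B : ℝ} (hd : ∀ k, x k ≤ d) (hB : 0 ≤ B)
    (hle : ∀ k < N', v < 2 * m k → xorSum m x k (v ^^^ m k) ≤ B) :
    xorSum m x N' v ≤ C * (d * B) := by
  refine (xorSum_le_sum (strictMono_of_ratio hq h0 hr) hv0 N').trans ?_
  have hd0 : 0 ≤ d := (hx 0).trans (hd 0)
  calc _ ≤ ∑ k ∈ Finset.range N' with v < 2 * m k, d * B := by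
        refine Finset.sum_le_sum fun k hk => ?_
        simp only [Finset.mem_filter, Finset.mem_range] at hk
        exact mul_le_mul (hd k) (hle k hk.1 hk.2) (xorSum_nonneg hx _ _) hd0
    _ ≤ _ := by
        rw [Finset.sum_const, nsmul_eq_mul]
        gcongr
        exact card_filter_le hq h0 hr hC hN hv

/-- The number of relations `m_{k_1} ^^^ ... ^^^ m_{k_l} = 0` in a lacunary sequence is so small
that the weighted count of them is close to `1` as soon as the sum of the cubes of the weights
is small. -/
theorem xorSum_zero_le (hq : 1 < q) : ∃ K : ℝ, 0 ≤ K ∧ ∀ (m : ℕ → ℕ) (_ : ∀ k, 0 < m k)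
    (_ : ∀ k, q * m k ≤ m (k + 1)) (x : ℕ → ℝ) (_ : ∀ k, 0 ≤ x k) (d : ℝ) (_ : ∀ k, x k ≤ d)
    (_ : d ≤ 1) (N : ℕ), xorSum m x N 0 ≤ Real.exp (K * (N * d ^ 3)) := by
  have hδ : 0 < 1 - q⁻¹ := by
    have := inv_lt_one_of_one_lt₀ hq; linarith
  -- `1 - q⁻¹` is the proportion of `m N` that survives the xor with a smaller term of the sequence.
  obtain ⟨C, hC⟩ : ∃ C : ℕ, 2 / (1 - q⁻¹) < q ^ C := pow_unbounded_of_one_lt _ hq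
  rw [div_lt_iff₀ hδ] at hC
  refine ⟨C ^ 2, by positivity, fun m h0 hr x hx d hd hd1 N => ?_⟩
  have hd0 : 0 ≤ d := (hx 0).trans (hd 0)
  have hx1 : ∀ k, x k ≤ 1 := fun k => (hd k).trans hd1
  have hmono := strictMono_of_ratio hq h0 hr
  -- A new relation contains `m N` and must have second and third largest members within `C` choices
  -- each. The three weights give `d ^ 3`, and the rest is bounded by the previous count.
  have step : ∀ N, xorSum m x (N + 1) 0 ≤ xorSum m x N 0 * (1 + C ^ 2 * d ^ 3) := by
    intro N
    have hB := xorSum_nonneg (m := m) hx N 0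
    have hmN : (0 : ℝ) < m N := by exact_mod_cast h0 N
    have key : xorSum m x N (m N) ≤ C * (d * (C * (d * xorSum m x N 0))) := by
      have hqi : 0 < q⁻¹ := by positivity
      refine xorSum_le_of_lacunary hq h0 hr (δ := 1 - q⁻¹) hC.le le_rfl (by nlinarith) (h0 N) hx hd
        (by positivity) fun k hk _ => ?_
      have hle : ((1 - q⁻¹) * m N : ℝ) ≤ (m N ^^^ m k : ℕ) := by
        have h1 : (m N : ℝ) ≤ m k + (m N ^^^ m k : ℕ) := by exact_mod_cast le_add_xor (m N) (m k)
        have h2 : (m k : ℝ) ≤ q⁻¹ * m N := by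
          rw [inv_mul_eq_div, le_div_iff₀ (by linarith), mul_comm]
          exact (hr k).trans (by exact_mod_cast hmono.monotone hk)
        linarith
      have hpos : 0 < m N ^^^ m k := by
        have : (0 : ℝ) < (m N ^^^ m k : ℕ) := lt_of_lt_of_le (by positivity) hle
        exact_mod_cast this
      refine xorSum_le_of_lacunary hq h0 hr hC.le hk.le hle hpos hx hd hB fun i hi _ => ?_
      exact (xorSum_le_zero hx hx1 _ _).trans (xorSum_mono hx 0 (hi.trans hk).le)
    have h1 : x N * xorSum m x N (m N) ≤ d * (C * (d * (C * (d * xorSum m x N 0)))) :=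
      mul_le_mul (hd N) key (xorSum_nonneg hx _ _) hd0
    rw [xorSum, Nat.zero_xor]
    nlinarith
  induction N with
  | zero => simp [xorSum]
  | succ N ih =>
    calc xorSum m x (N + 1) 0 ≤ xorSum m x N 0 * (1 + C ^ 2 * d ^ 3) := step N
      _ ≤ Real.exp (C ^ 2 * (N * d ^ 3)) * Real.exp (C ^ 2 * d ^ 3) := by
        gcongr
        have := Real.add_one_le_exp (C ^ 2 * d ^ 3 : ℝ)
        linarith
      _ = _ := by rw [← Real.exp_add]; congr 1; push_cast; ring

/-- With ratios at least `2`, no earlier term satisfies `m N < 2 * m k`, so no relation has `m N` as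
its largest member. -/
theorem xorSum_zero_eq_one (hq : 2 ≤ q) (h0 : ∀ k, 0 < m k) (hr : ∀ k, q * m k ≤ m (k + 1))
    (hx : ∀ k, 0 ≤ x k) (N : ℕ) : xorSum m x N 0 = 1 := by
  have hmono := strictMono_of_ratio (by linarith) h0 hr
  induction N with
  | zero => simp [xorSum]
  | succ N ih =>
    have h := xorSum_le_sum (x := x) hmono (h0 N) N
    rw [Finset.filter_false_of_mem, Finset.sum_empty] at h
    · rw [xorSum, ih, Nat.zero_xor, le_antisymm h (xorSum_nonneg hx _ _)]; simp
    · intro k hk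
      have h1 : (m (k + 1) : ℝ) ≤ m N := by
        exact_mod_cast hmono.monotone (Finset.mem_range.1 hk)
      have h2 : (2 * m k : ℝ) ≤ m N := by
        have := hr k
        have : (0 : ℝ) ≤ m k := by positivity
        nlinarith
      have : 2 * m k ≤ m N := by exact_mod_cast h2
      omega

end Lacunary

/-! ### Mod-Gaussian convergence of Walsh sums -/

open ProbabilityTheory

/-- Mod-Gaussian convergence of the laws `P n`, with parameters `A n ^ 2` and with limiting
function `exp (-κ z ^ 4 / 12)`, locally uniformly in the complex plane. -/
def IsModGaussian (P : ℕ → Measure ℝ) (A : ℕ → ℝ) (κ : ℝ) : Prop :=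
  ∀ R ε : ℝ, 0 < ε → ∀ᶠ n in atTop, ∀ z : ℂ, ‖z‖ ≤ R →
    ‖complexMGF id (P n) z * Complex.exp (-(A n ^ 2 * z ^ 2 / 2) + κ * z ^ 4 / 12) - 1‖ ≤ ε

theorem norm_cosh_mul_exp_sub_one_le {w : ℂ} (hw : ‖w‖ ≤ 1) :
    ‖Complex.cosh w * Complex.exp (-(w ^ 2 / 2) + w ^ 4 / 12) - 1‖ ≤ 6 * ‖w‖ ^ 5 := by
  set r := ‖w‖
  have hr : 0 ≤ r := norm_nonneg w
  have hp : ∀ i : ℕ, ‖w ^ i‖ = r ^ i := fun i => norm_pow _ _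
  have h1 := Complex.exp_bound (x := w) hw (n := 5) (by norm_num)
  have h2 := Complex.exp_bound (x := -w) (by simpa using hw) (n := 5) (by norm_num)
  rw [norm_neg] at h2
  simp only [Finset.sum_range_succ, Finset.sum_range_zero, Nat.factorial] at h1 h2
  norm_num at h1 h2
  have hcosh : ‖Complex.cosh w - (1 + w ^ 2 / 2 + w ^ 4 / 24)‖ ≤ r ^ 5 / 100 := by
    have e : Complex.cosh w - (1 + w ^ 2 / 2 + w ^ 4 / 24)
        = ((Complex.exp w - (1 + w + w ^ 2 / 2 + w ^ 3 / 6 + w ^ 4 / 24))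
          + (Complex.exp (-w) - (1 + -w + w ^ 2 / 2 + (-w) ^ 3 / 6 + w ^ 4 / 24))) / 2 := by
      rw [Complex.cosh]; ring
    rw [e, norm_div, Complex.norm_two]
    have := (norm_add_le _ _).trans (add_le_add h1 h2)
    linarith
  -- The Taylor polynomial of `log cosh` of degree 4: with it `exp u` and `cosh w` agree up to terms
  -- of order `w ^ 6`, more than the fifth order needed here.
  set u := w ^ 2 / 2 - w ^ 4 / 12 with hu
  have hr5 : 0 ≤ r ^ 5 := by positivity
  have hur : ‖u‖ ≤ 7 / 12 * r ^ 2 := by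
    have h3 : ‖u‖ ≤ r ^ 2 / 2 + r ^ 4 / 12 := by
      refine (norm_sub_le _ _).trans (le_of_eq ?_)
      simp [r]
    have : r ^ 4 ≤ r ^ 2 := pow_le_pow_of_le_one hr hw (by norm_num)
    linarith
  have hu1 : ‖u‖ ≤ 1 := by
    have : r ^ 2 ≤ 1 := pow_le_one₀ hr hw
    linarith
  have h3 := Complex.exp_bound (x := u) hu1 (n := 3) (by norm_num)
  simp only [Finset.sum_range_succ, Finset.sum_range_zero, Nat.factorial] at h3
  norm_num at h3
  have h6 : r ^ 6 ≤ r ^ 5 := pow_le_pow_of_le_one hr hw (by norm_num)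
  have h8 : r ^ 8 ≤ r ^ 5 := pow_le_pow_of_le_one hr hw (by norm_num)
  have hu3 : ‖u‖ ^ 3 ≤ r ^ 5 := by
    calc ‖u‖ ^ 3 ≤ (7 / 12 * r ^ 2) ^ 3 := by gcongr
      _ = (7 / 12) ^ 3 * r ^ 6 := by ring
      _ ≤ r ^ 5 := by nlinarith
  have h4 : ‖(1 + u + u ^ 2 / 2) - (1 + w ^ 2 / 2 + w ^ 4 / 24)‖ ≤ r ^ 5 / 12 := by
    have e : (1 + u + u ^ 2 / 2) - (1 + w ^ 2 / 2 + w ^ 4 / 24) = w ^ 8 / 288 - w ^ 6 / 24 := by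
      rw [hu]; ring
    rw [e]
    refine (norm_sub_le _ _).trans ?_
    rw [norm_div, norm_div, hp, hp]
    norm_num
    linarith
  have h5 : ‖Complex.cosh w - Complex.exp u‖ ≤ 2 * r ^ 5 := by
    have e : Complex.cosh w - Complex.exp u
        = (Complex.cosh w - (1 + w ^ 2 / 2 + w ^ 4 / 24))
          - (Complex.exp u - (1 + u + u ^ 2 / 2))
          - ((1 + u + u ^ 2 / 2) - (1 + w ^ 2 / 2 + w ^ 4 / 24)) := by ring
    rw [e]
    refine (norm_sub_le _ _).trans ?_
    have := norm_sub_le (Complex.cosh w - (1 + w ^ 2 / 2 + w ^ 4 / 24))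
      (Complex.exp u - (1 + u + u ^ 2 / 2))
    linarith
  have e : Complex.cosh w * Complex.exp (-(w ^ 2 / 2) + w ^ 4 / 12) - 1
      = (Complex.cosh w - Complex.exp u) * Complex.exp (-u) := by
    rw [sub_mul, ← Complex.exp_add, add_neg_cancel, Complex.exp_zero, hu]
    congr 3; ring
  have h7 : ‖Complex.exp (-u)‖ ≤ 3 := by
    rw [Complex.norm_exp]
    have : (-u).re ≤ 1 := (Complex.re_le_norm _).trans (by rwa [norm_neg])
    have := Real.exp_le_exp.2 this
    have := Real.exp_one_lt_d9
    linarith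
  rw [e, norm_mul]
  calc _ ≤ 2 * r ^ 5 * 3 := by gcongr
    _ = _ := by ring

theorem norm_cosh_sub_one_le {w : ℂ} (hw : ‖w‖ ≤ 1) : ‖Complex.cosh w - 1‖ ≤ 2 * ‖w‖ := by
  have h1 := Complex.norm_exp_sub_one_le hw
  have h2 := Complex.norm_exp_sub_one_le (x := -w) (by simpa using hw)
  rw [norm_neg] at h2
  have e : Complex.cosh w - 1 = ((Complex.exp w - 1) + (Complex.exp (-w) - 1)) / 2 := by
    rw [Complex.cosh]; ring
  rw [e, norm_div, Complex.norm_two]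
  have := norm_add_le (Complex.exp w - 1) (Complex.exp (-w) - 1)
  linarith

theorem norm_sinh_le {w : ℂ} (hw : ‖w‖ ≤ 1) : ‖Complex.sinh w‖ ≤ 2 * ‖w‖ := by
  have h1 := Complex.norm_exp_sub_one_le hw
  have h2 := Complex.norm_exp_sub_one_le (x := -w) (by simpa using hw)
  rw [norm_neg] at h2
  have e : Complex.sinh w = ((Complex.exp w - 1) - (Complex.exp (-w) - 1)) / 2 := by
    rw [Complex.sinh]; ring
  rw [e, norm_div, Complex.norm_two]
  have := norm_sub_le (Complex.exp w - 1) (Complex.exp (-w) - 1)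
  linarith

theorem half_le_norm_cosh {w : ℂ} (hw : ‖w‖ ≤ 1 / 4) : 1 / 2 ≤ ‖Complex.cosh w‖ := by
  have h1 := norm_cosh_sub_one_le (hw.trans (by norm_num))
  have h2 := norm_sub_norm_le (1 : ℂ) (1 - Complex.cosh w)
  rw [norm_sub_rev] at h1
  simp only [norm_one, sub_sub_cancel] at h2
  linarith

theorem norm_tanh_le {w : ℂ} (hw : ‖w‖ ≤ 1 / 4) : ‖Complex.tanh w‖ ≤ 4 * ‖w‖ := by
  have h1 := norm_sinh_le (hw.trans (by norm_num))
  have h2 := half_le_norm_cosh hw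
  rw [Complex.tanh_eq_sinh_div_cosh, norm_div, div_le_iff₀ (by linarith)]
  have := norm_nonneg w
  nlinarith

theorem cexp_mul_walsh (z : ℂ) (b : ℝ) (n : ℕ) (x : ℝ) (h : Complex.cosh (z * b) ≠ 0) :
    Complex.exp (z * (b * walsh n x : ℝ))
      = Complex.cosh (z * b) * (1 + Complex.tanh (z * b) * (walsh n x : ℂ)) := by
  rw [Complex.tanh_eq_sinh_div_cosh]
  rcases walsh_eq_one_or n x with hw | hw
  · rw [hw]; push_cast
    rw [mul_one, mul_one, mul_add, mul_div_cancel₀ _ h, mul_one, Complex.cosh_add_sinh]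
  · rw [hw]; push_cast
    rw [mul_add, mul_neg_one, mul_neg_one, mul_neg, mul_neg, mul_div_cancel₀ _ h, mul_one,
      ← sub_eq_add_neg, Complex.cosh_sub_sinh]

theorem integral_cexp_sum_walsh (m : ℕ → ℕ) (b : ℕ → ℝ) (N : ℕ) (z : ℂ)
    (h : ∀ k, Complex.cosh (z * b k) ≠ 0) :
    ∫ x, Complex.exp (z * (∑ k ∈ Finset.range N, b k * walsh (m k) x : ℝ)) ∂unitMeasure
      = (∏ k ∈ Finset.range N, Complex.cosh (z * b k))
        * xorSum m (fun k => Complex.tanh (z * b k)) N 0 := by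
  rw [← integral_walsh_mul_prod, ← integral_const_mul]
  congr 1; ext x
  rw [Complex.ofReal_sum, Finset.mul_sum, Complex.exp_sum, walsh_zero,
    Finset.prod_congr rfl fun k _ => cexp_mul_walsh z (b k) (m k) x (h k),
    Finset.prod_mul_distrib]
  simp

theorem norm_mul_mul_sub_one_le {X Y Z : ℂ} {x y z : ℝ} (hX : ‖X - 1‖ ≤ x) (hY : ‖Y - 1‖ ≤ y)
    (hZ : ‖Z - 1‖ ≤ z) : ‖X * Y * Z - 1‖ ≤ (1 + x) * (1 + y) * (1 + z) - 1 := by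
  have h2 : ∀ {X Y : ℂ} {x y : ℝ}, ‖X - 1‖ ≤ x → ‖Y - 1‖ ≤ y →
      ‖X * Y - 1‖ ≤ (1 + x) * (1 + y) - 1 := by
    intro X Y x y hX hY
    have e : X * Y - 1 = (X - 1) * (Y - 1) + (X - 1) + (Y - 1) := by ring
    rw [e]
    refine norm_add₃_le.trans ?_
    rw [norm_mul]
    have := mul_le_mul hX hY (norm_nonneg _) ((norm_nonneg _).trans hX)
    linarith
  have := h2 (h2 hX hY) hZ
  linarith

theorem norm_exp_sub_one_le_exp (z : ℂ) : ‖Complex.exp z - 1‖ ≤ Real.exp ‖z‖ - 1 := by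
  convert Complex.norm_exp_sub_sum_le_exp_norm_sub_sum z 1 <;> simp

/-- The estimate behind mod-Gaussian convergence. -/
theorem norm_integral_mul_exp_sub_one_le (m : ℕ → ℕ) (b : ℕ → ℝ) (N : ℕ) {d R β κ : ℝ}
    (hb : ∀ k, |b k| ≤ d) (hR : 0 ≤ R) (hRd : R * d ≤ 1 / 4)
    (hβ : ∀ x : ℕ → ℝ, (∀ k, 0 ≤ x k) → (∀ k, x k ≤ 4 * (R * d)) → xorSum m x N 0 ≤ β)
    {z : ℂ} (hz : ‖z‖ ≤ R) :
    ‖(∫ x, Complex.exp (z * (∑ k ∈ Finset.range N, b k * walsh (m k) x : ℝ)) ∂unitMeasure)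
      * Complex.exp (-((∑ k ∈ Finset.range N, b k ^ 2 : ℝ) * z ^ 2 / 2) + κ * z ^ 4 / 12) - 1‖
      ≤ Real.exp (6 * R ^ 5 * (d * ∑ k ∈ Finset.range N, b k ^ 4)) * β
        * Real.exp (|κ - ∑ k ∈ Finset.range N, b k ^ 4| * R ^ 4 / 12) - 1 := by
  have hd : 0 ≤ d := (abs_nonneg _).trans (hb 0)
  have hzb : ∀ k, ‖z * b k‖ ≤ R * d := fun k => by
    rw [norm_mul, Complex.norm_real, Real.norm_eq_abs]
    exact mul_le_mul hz (hb k) (abs_nonneg _) hR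
  have hcosh : ∀ k, Complex.cosh (z * b k) ≠ 0 := fun k h => by
    have := half_le_norm_cosh ((hzb k).trans hRd)
    rw [h] at this; norm_num at this
  rw [integral_cexp_sum_walsh m b N z hcosh]
  set f : ℕ → ℂ := fun k => Complex.cosh (z * b k) *
    -- Each `cosh` is paired with its own Gaussian and quartic correction. Three factors near `1`
    -- remain: these products, the relation count, and the discrepancy between `κ` and the sum of
    -- fourth powers.
    Complex.exp (-((z * b k) ^ 2 / 2) + (z * b k) ^ 4 / 12) with hf
  set X := xorSum m (fun k => Complex.tanh (z * b k)) N 0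
  have e : (∏ k ∈ Finset.range N, Complex.cosh (z * b k)) * X *
      Complex.exp (-((∑ k ∈ Finset.range N, b k ^ 2 : ℝ) * z ^ 2 / 2) + κ * z ^ 4 / 12)
      = (∏ k ∈ Finset.range N, f k) * X *
        Complex.exp ((κ - ∑ k ∈ Finset.range N, b k ^ 4 : ℝ) * z ^ 4 / 12) := by
    rw [hf, Finset.prod_mul_distrib, ← Complex.exp_sum]
    have : -((∑ k ∈ Finset.range N, b k ^ 2 : ℝ) * z ^ 2 / 2) + κ * z ^ 4 / 12
        = (∑ k ∈ Finset.range N, (-((z * b k) ^ 2 / 2) + (z * b k) ^ 4 / 12))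
          + (κ - ∑ k ∈ Finset.range N, b k ^ 4 : ℝ) * z ^ 4 / 12 := by
      push_cast
      rw [Finset.sum_add_distrib, Finset.sum_neg_distrib, ← Finset.sum_div, ← Finset.sum_div]
      simp only [mul_pow, ← Finset.mul_sum]
      ring
    rw [this, Complex.exp_add]; ring
  rw [e]
  have h1 : ‖∏ k ∈ Finset.range N, f k - 1‖
      ≤ Real.exp (6 * R ^ 5 * (d * ∑ k ∈ Finset.range N, b k ^ 4)) - 1 := by
    have h := Finset.norm_prod_one_add_sub_one_le (Finset.range N) fun k => f k - 1
    simp only [add_sub_cancel] at h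
    refine h.trans (sub_le_sub_right (Real.exp_le_exp.2 ?_) 1)
    rw [Finset.mul_sum, Finset.mul_sum]
    refine Finset.sum_le_sum fun k _ => ?_
    refine (norm_cosh_mul_exp_sub_one_le ((hzb k).trans (by linarith))).trans ?_
    rw [norm_mul, Complex.norm_real, Real.norm_eq_abs, mul_pow, mul_assoc]
    refine mul_le_mul_of_nonneg_left ?_ (by norm_num)
    have h4 : |b k| ^ 5 ≤ d * b k ^ 4 := by
      calc |b k| ^ 5 = |b k| * |b k| ^ 4 := by ring
        _ ≤ d * |b k| ^ 4 := by gcongr; exact hb k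
        _ = _ := by rw [Even.pow_abs (by decide)]
    gcongr
  have h2 : ‖X - 1‖ ≤ β - 1 := by
    have h := norm_xorSum_sub_le m (fun k => Complex.tanh (z * b k)) N 0
    simp only [if_true] at h
    refine h.trans (sub_le_sub_right (hβ _ (fun k => norm_nonneg _) fun k => ?_) 1)
    refine (norm_tanh_le ((hzb k).trans hRd)).trans ?_
    linarith [hzb k]
  have h3 : ‖Complex.exp ((κ - ∑ k ∈ Finset.range N, b k ^ 4 : ℝ) * z ^ 4 / 12) - 1‖
      ≤ Real.exp (|κ - ∑ k ∈ Finset.range N, b k ^ 4| * R ^ 4 / 12) - 1 := by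
    refine (norm_exp_sub_one_le_exp _).trans (sub_le_sub_right (Real.exp_le_exp.2 ?_) 1)
    rw [norm_div, norm_mul, Complex.norm_real, Real.norm_eq_abs, norm_pow]
    norm_num
    gcongr
  have := norm_mul_mul_sub_one_le h1 h2 h3
  simpa using this

theorem isModGaussian_of_tendsto (m : ℕ → ℕ) (b : ℕ → ℕ → ℝ) {A d : ℕ → ℝ} {κ : ℝ}
    (hA : ∀ n, A n ^ 2 = ∑ k ∈ Finset.range n, b n k ^ 2) (hb : ∀ n k, |b n k| ≤ d n)
    (hd : Tendsto d atTop (𝓝 0))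
    (hκ : Tendsto (fun n => ∑ k ∈ Finset.range n, b n k ^ 4) atTop (𝓝 κ))
    (hX : ∀ R : ℝ, 0 ≤ R → ∃ β : ℕ → ℝ, Tendsto β atTop (𝓝 1) ∧ ∀ n, R * d n ≤ 1 →
      ∀ x : ℕ → ℝ, (∀ k, 0 ≤ x k) → (∀ k, x k ≤ R * d n) → xorSum m x n 0 ≤ β n) :
    IsModGaussian
      (fun n => unitMeasure.map fun x => ∑ k ∈ Finset.range n, b n k * walsh (m k) x) A κ := by
  intro R ε hε
  -- `R` may be negative, while the estimate needs a nonnegative radius; the factor `4` below comes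
  -- from `norm_tanh_le`.
  set R' := max R 0
  have hR' : 0 ≤ R' := le_max_right _ _
  obtain ⟨β, hβ, hle⟩ := hX (4 * R') (by positivity)
  have h1 : ∀ᶠ n in atTop, R' * d n ≤ 1 / 4 := by
    have : Tendsto (fun n => R' * d n) atTop (𝓝 (R' * 0)) := hd.const_mul R'
    rw [mul_zero] at this
    exact this.eventually_le_const (by norm_num)
  have h2 : Tendsto (fun n => Real.exp (6 * R' ^ 5 * (d n * ∑ k ∈ Finset.range n, b n k ^ 4)) * β n
        * Real.exp (|κ - ∑ k ∈ Finset.range n, b n k ^ 4| * R' ^ 4 / 12) - 1) atTop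
      (𝓝 (Real.exp (6 * R' ^ 5 * (0 * κ)) * 1 * Real.exp (|κ - κ| * R' ^ 4 / 12) - 1)) := by
    have h3 := (Real.continuous_exp.tendsto _).comp ((hd.mul hκ).const_mul (6 * R' ^ 5))
    have h4 := (Real.continuous_exp.tendsto _).comp
      ((((tendsto_const_nhds (x := κ)).sub hκ).abs.mul_const (R' ^ 4)).div_const 12)
    exact ((h3.mul hβ).mul h4).sub_const 1
  simp only [zero_mul, mul_zero, Real.exp_zero, sub_self, abs_zero, zero_div, mul_one] at h2
  filter_upwards [h1, h2.eventually_le_const hε] with n hn1 hn2 z hz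
  refine le_trans ?_ hn2
  have hmeas : Measurable fun x => ∑ k ∈ Finset.range n, b n k * walsh (m k) x :=
    Finset.measurable_sum _ fun k _ => (measurable_walsh _).const_mul _
  rw [complexMGF_id_map hmeas.aemeasurable, complexMGF]
  have := norm_integral_mul_exp_sub_one_le m (b n) n (hb n) hR' hn1 (κ := κ) (β := β n)
    (fun x h0 hx => hle n (by linarith) x h0 fun k => (hx k).trans (by linarith))
    (hz.trans (le_max_left _ _))
  rw [← hA] at this
  exact_mod_cast this

/-! ### A positive kernel with compactly supported Fourier transform -/

open BoundedContinuousFunction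

/-- The Fejér kernel `(1 - cos v) / v ^ 2`, written as a Fourier transform. -/
noncomputable def fejer (v : ℝ) : ℝ := ∫ t in (0 : ℝ)..1, (1 - t) * Real.cos (t * v)

theorem sq_mul_fejer (v : ℝ) : v ^ 2 * fejer v = 1 - Real.cos v := by
  rw [fejer, ← intervalIntegral.integral_const_mul]
  have h : ∀ t ∈ Set.uIcc (0 : ℝ) 1,
      HasDerivAt (fun t => (1 - t) * (v * Real.sin (t * v)) - Real.cos (t * v))
        (v ^ 2 * ((1 - t) * Real.cos (t * v))) t := by
    intro t _
    have h1 : HasDerivAt (fun t => t * v) v t := by simpa using (hasDerivAt_id t).mul_const v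
    have h2 := ((hasDerivAt_id t).const_sub 1).mul ((h1.sin).const_mul v)
    exact (h2.sub h1.cos).congr_deriv (by simp only [id]; ring)
  rw [intervalIntegral.integral_eq_sub_of_hasDerivAt h
    (Continuous.intervalIntegrable (by fun_prop) _ _)]
  simp
  ring

theorem continuous_fejer : Continuous fejer := by
  unfold fejer
  exact intervalIntegral.continuous_parametric_intervalIntegral_of_continuous' (by fun_prop) 0 1

theorem fejer_zero : fejer 0 = 1 / 2 := by
  simp only [fejer, mul_zero, Real.cos_zero, mul_one]
  rw [intervalIntegral.integral_sub (by simp) (by simp)]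
  simp; norm_num

theorem fejer_nonneg (v : ℝ) : 0 ≤ fejer v := by
  rcases eq_or_ne v 0 with rfl | hv
  · rw [fejer_zero]; norm_num
  · have h := sq_mul_fejer v
    have h1 : 0 < v ^ 2 := by positivity
    have h2 := Real.cos_le_one v
    by_contra! hneg
    nlinarith

theorem fejer_le_one (v : ℝ) : fejer v ≤ 1 := by
  have h : ‖fejer v‖ ≤ 1 * |1 - 0| := by
    refine intervalIntegral.norm_integral_le_of_norm_le_const fun t ht => ?_
    rw [Set.uIoc_of_le zero_le_one] at ht
    rw [norm_mul, Real.norm_eq_abs, Real.norm_eq_abs, abs_of_nonneg (by linarith [ht.2])]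
    have := Real.abs_cos_le_one (t * v)
    have := abs_nonneg (Real.cos (t * v))
    nlinarith [ht.1, ht.2]
  exact (le_abs_self _).trans (by simpa using h)

theorem fejer_le (v : ℝ) : fejer v ≤ 3 * (1 + v ^ 2)⁻¹ := by
  rw [← div_eq_mul_inv, le_div_iff₀ (by positivity)]
  have h := sq_mul_fejer v
  have h1 := fejer_le_one v
  have h2 := Real.neg_one_le_cos v
  linarith

theorem integrable_fejer : Integrable fejer := by
  refine (integrable_inv_one_add_sq.const_mul 3).mono' continuous_fejer.aestronglyMeasurable
    (Eventually.of_forall fun v => ?_)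
  rw [Real.norm_eq_abs, abs_of_nonneg (fejer_nonneg v)]
  exact fejer_le v

/-- A strictly positive kernel whose Fourier transform has compact support. -/
noncomputable def posKernel (v : ℝ) : ℝ := fejer v + fejer (v + Real.pi)

theorem continuous_posKernel : Continuous posKernel :=
  continuous_fejer.add (continuous_fejer.comp (by fun_prop))

theorem integrable_posKernel : Integrable posKernel :=
  integrable_fejer.add (integrable_fejer.comp_add_right Real.pi)

/-- The zeros of the two Fejér kernels interlace: the numerators `1 - cos v` and `1 + cos v` add up
to `2`. Thus the kernel is positive and decays no faster than quadratically. -/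
theorem two_le_mul_posKernel (v : ℝ) : 2 ≤ (|v| + Real.pi) ^ 2 * posKernel v := by
  have h1 := sq_mul_fejer v
  have h2 := sq_mul_fejer (v + Real.pi)
  rw [Real.cos_add_pi] at h2
  have h3 : v ^ 2 ≤ (|v| + Real.pi) ^ 2 := by
    rw [← sq_abs v]; gcongr; linarith [Real.pi_pos]
  have h4 : (v + Real.pi) ^ 2 ≤ (|v| + Real.pi) ^ 2 := by
    rw [← sq_abs (v + Real.pi)]; gcongr
    refine (abs_add_le _ _).trans ?_
    rw [abs_of_pos Real.pi_pos]
  have h5 := mul_le_mul_of_nonneg_right h3 (fejer_nonneg v)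
  have h6 := mul_le_mul_of_nonneg_right h4 (fejer_nonneg (v + Real.pi))
  rw [posKernel]
  linarith

theorem posKernel_pos (v : ℝ) : 0 < posKernel v := by
  have h := two_le_mul_posKernel v
  by_contra! hneg
  have : (|v| + Real.pi) ^ 2 * posKernel v ≤ 0 :=
    mul_nonpos_of_nonneg_of_nonpos (by positivity) hneg
  linarith

theorem exp_neg_abs_le (v : ℝ) : Real.exp (-|v|) ≤ Real.exp Real.pi * posKernel v := by
  have h1 := two_le_mul_posKernel v
  have h2 := Real.quadratic_le_exp_of_nonneg (x := |v| + Real.pi) (by positivity)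
  have h3 : (|v| + Real.pi) ^ 2 ≤ 2 * Real.exp (|v| + Real.pi) := by
    have := Real.pi_pos
    have := abs_nonneg v
    linarith
  have h4 : 1 ≤ Real.exp (|v| + Real.pi) * posKernel v := by
    have := mul_le_mul_of_nonneg_right h3 (posKernel_pos v).le
    linarith
  have h5 := mul_le_mul_of_nonneg_left h4 (Real.exp_pos (-|v|)).le
  rw [mul_one, ← mul_assoc, ← Real.exp_add] at h5
  simpa using h5

/-- By Fubini, such an integral depends only on the characteristic function on `[η - 1, η + 1]`. -/
theorem integral_fejer_mul_cexp (ν : Measure ℝ) [IsProbabilityMeasure ν] (b η : ℝ) :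
    ∫ v, (fejer (v + b) : ℂ) * Complex.exp (η * v * Complex.I) ∂ν
      = ∫ t in (0 : ℝ)..1, (1 - t) / 2 *
          (Complex.exp (t * b * Complex.I) * charFun ν (η + t)
            + Complex.exp (-(t * b * Complex.I)) * charFun ν (η - t)) := by
  have hint : ∀ ξ : ℝ, Integrable (fun v : ℝ => Complex.exp (ξ * v * Complex.I)) ν := fun ξ => by
    refine Integrable.of_bound (C := 1) (Continuous.aestronglyMeasurable (by fun_prop))
      (Eventually.of_forall fun v => ?_)
    rw [← Complex.ofReal_mul, Complex.norm_exp_ofReal_mul_I]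
  have h1 : ∀ t : ℝ, (1 - t) / 2 *
          (Complex.exp (t * b * Complex.I) * charFun ν (η + t)
            + Complex.exp (-(t * b * Complex.I)) * charFun ν (η - t))
      = ∫ v, ((1 - t) * Complex.cos (t * (v + b)) * Complex.exp (η * v * Complex.I) : ℂ) ∂ν := by
    intro t
    rw [charFun_apply_real, charFun_apply_real, ← integral_const_mul, ← integral_const_mul,
      ← integral_add ((hint _).const_mul _) ((hint _).const_mul _), ← integral_const_mul]
    congr 1; ext v
    rw [← Complex.exp_add, ← Complex.exp_add, Complex.cos]
    rw [show (1 - t : ℂ) * ((Complex.exp (t * (v + b) * Complex.I)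
      + Complex.exp (-(t * (v + b)) * Complex.I)) / 2) * Complex.exp (η * v * Complex.I)
      = (1 - t) / 2 * (Complex.exp (t * (v + b) * Complex.I) * Complex.exp (η * v * Complex.I)
      + Complex.exp (-(t * (v + b)) * Complex.I) * Complex.exp (η * v * Complex.I)) by ring,
      ← Complex.exp_add, ← Complex.exp_add]
    push_cast
    ring_nf
  simp_rw [h1]
  have h2 : ∀ v : ℝ, (fejer (v + b) : ℂ) * Complex.exp (η * v * Complex.I)
      = ∫ t in (0 : ℝ)..1,
        ((1 - t) * Complex.cos (t * (v + b)) * Complex.exp (η * v * Complex.I) : ℂ) := by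
    intro v
    rw [intervalIntegral.integral_mul_const, fejer, ← intervalIntegral.integral_ofReal]
    push_cast
    rfl
  simp_rw [h2, intervalIntegral.integral_of_le zero_le_one]
  refine integral_integral_swap ?_
  have : IsFiniteMeasure (volume.restrict (Set.Ioc (0 : ℝ) 1)) := inferInstance
  refine Integrable.of_bound (C := 1) (Continuous.aestronglyMeasurable ?_) ?_
  · simp only [Function.uncurry_def]; fun_prop
  · rw [Measure.ae_prod_iff_ae_ae]
    · refine Eventually.of_forall fun v => ?_
      refine (ae_restrict_mem measurableSet_Ioc).mono fun t ht => ?_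
      simp only [Function.uncurry_def]
      rw [norm_mul, norm_mul, ← Complex.ofReal_mul, Complex.norm_exp_ofReal_mul_I, mul_one]
      norm_cast
      rw [Real.norm_eq_abs, Real.norm_eq_abs, abs_of_nonneg (by linarith [ht.2])]
      have := Real.abs_cos_le_one (t * (v + b))
      have := abs_nonneg (Real.cos (t * (v + b)))
      nlinarith [ht.1, ht.2]
    · refine measurableSet_le (Continuous.measurable ?_) measurable_const
      simp only [Function.uncurry_def]; fun_prop

theorem norm_integral_fejer_sub_le (ν ν' : Measure ℝ) [IsProbabilityMeasure ν]
    [IsProbabilityMeasure ν'] (b η : ℝ) {R : ℝ} (hR : |η| + 1 ≤ R) :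
    ‖(∫ v, (fejer (v + b) : ℂ) * Complex.exp (η * v * Complex.I) ∂ν)
      - ∫ v, (fejer (v + b) : ℂ) * Complex.exp (η * v * Complex.I) ∂ν'‖
      ≤ ∫ ξ in (-R)..R, ‖charFun ν ξ - charFun ν' ξ‖ := by
  set D : ℝ → ℝ := fun ξ => ‖charFun ν ξ - charFun ν' ξ‖ with hD
  have hDm : Measurable D := (measurable_charFun.sub measurable_charFun).norm
  have hD2 : ∀ ξ, ‖D ξ‖ ≤ 2 := fun ξ => by
    rw [hD, norm_norm]
    refine (norm_sub_le _ _).trans ?_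
    have := norm_charFun_le_one (μ := ν) ξ
    have := norm_charFun_le_one (μ := ν') ξ
    linarith
  have bdd : ∀ {E : Type} [NormedAddCommGroup E] (f : ℝ → E) (C a b : ℝ),
      AEStronglyMeasurable f volume → (∀ x ∈ Set.uIoc a b, ‖f x‖ ≤ C) → IntervalIntegrable f volume a b := by
    intro E _ f C a b hm hf
    rw [intervalIntegrable_iff]
    refine Measure.integrableOn_of_bounded (M := C) ?_ hm ?_
    · simp
    · exact (ae_restrict_mem measurableSet_uIoc).mono hf
  have hDi : ∀ a b, IntervalIntegrable D volume a b := fun a b =>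
    bdd D 2 a b hDm.aestronglyMeasurable fun x _ => hD2 x
  have hi : ∀ (ρ : Measure ℝ) [IsProbabilityMeasure ρ], IntervalIntegrable
      (fun t : ℝ => (1 - t : ℂ) / 2 *
          (Complex.exp (t * b * Complex.I) * charFun ρ (η + t)
            + Complex.exp (-(t * b * Complex.I)) * charFun ρ (η - t))) volume 0 1 := by
    intro ρ _
    refine bdd _ 1 _ _ (Measurable.aestronglyMeasurable ?_) fun t ht => ?_
    · have h1 : Measurable fun t : ℝ => charFun ρ (η + t) :=
        measurable_charFun.comp (measurable_const.add measurable_id)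
      have h2 : Measurable fun t : ℝ => charFun ρ (η - t) :=
        measurable_charFun.comp (measurable_const.sub measurable_id)
      have h3 : Measurable fun t : ℝ => Complex.exp (t * b * Complex.I) :=
        Continuous.measurable (by fun_prop)
      have h4 : Measurable fun t : ℝ => Complex.exp (-(t * b * Complex.I)) :=
        Continuous.measurable (by fun_prop)
      have h5 : Measurable fun t : ℝ => (1 - t : ℂ) / 2 := Continuous.measurable (by fun_prop)
      exact h5.mul ((h3.mul h1).add (h4.mul h2))
    · rw [Set.uIoc_of_le zero_le_one] at ht
      have h1 : ‖(1 - t : ℂ) / 2‖ ≤ 1 / 2 := by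
        rw [norm_div, Complex.norm_two, ← Complex.ofReal_one, ← Complex.ofReal_sub,
          Complex.norm_real, Real.norm_eq_abs, abs_of_nonneg (by linarith [ht.2])]
        linarith [ht.1]
      have h2 : ‖Complex.exp (t * b * Complex.I) * charFun ρ (η + t)
            + Complex.exp (-(t * b * Complex.I)) * charFun ρ (η - t)‖ ≤ 2 := by
        refine (norm_add_le _ _).trans ?_
        rw [norm_mul, norm_mul, ← Complex.ofReal_mul, ← neg_mul, ← Complex.ofReal_neg,
          Complex.norm_exp_ofReal_mul_I, Complex.norm_exp_ofReal_mul_I]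
        have := norm_charFun_le_one (μ := ρ) (η + t)
        have := norm_charFun_le_one (μ := ρ) (η - t)
        linarith
      rw [norm_mul]
      calc _ ≤ 1 / 2 * (2 : ℝ) := by gcongr
        _ = 1 := by norm_num
  rw [integral_fejer_mul_cexp, integral_fejer_mul_cexp, ← intervalIntegral.integral_sub (hi ν) (hi ν')]
  have hplus : ∫ t in (0 : ℝ)..1, D (η + t) = ∫ t in η..(η + 1), D t := by simp
  have hminus : ∫ t in (0 : ℝ)..1, D (η - t) = ∫ t in (η - 1)..η, D t := by simp
  have ha := abs_le.1 (le_refl |η|)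
  have hsub : ∀ a b, -R ≤ a → a ≤ b → b ≤ R → ∫ t in a..b, D t ≤ ∫ t in (-R)..R, D t := by
    intro a b h1 h2 h3
    exact intervalIntegral.integral_mono_interval h1 h2 h3
      (Eventually.of_forall fun x => norm_nonneg _) (hDi _ _)
  have hip : IntervalIntegrable (fun t => D (η + t)) volume 0 1 :=
    bdd _ 2 _ _ (hDm.comp (measurable_const.add measurable_id)).aestronglyMeasurable
      fun x _ => hD2 _
  have him : IntervalIntegrable (fun t => D (η - t)) volume 0 1 :=
    bdd _ 2 _ _ (hDm.comp (measurable_const.sub measurable_id)).aestronglyMeasurable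
      fun x _ => hD2 _
  calc _ ≤ ∫ t in (0 : ℝ)..1, (1 / 2) * (D (η + t) + D (η - t)) := by
        refine intervalIntegral.norm_integral_le_of_norm_le zero_le_one
          (Eventually.of_forall fun t ht => ?_) ((hip.add him).const_mul _)
        rw [← mul_sub, norm_mul]
        refine mul_le_mul ?_ ?_ (norm_nonneg _) (by norm_num)
        · rw [norm_div, Complex.norm_two, ← Complex.ofReal_one, ← Complex.ofReal_sub,
            Complex.norm_real, Real.norm_eq_abs, abs_of_nonneg (by linarith [ht.2])]
          linarith [ht.1]
        · rw [show ∀ x y z w p r : ℂ, x * y + z * w - (x * p + z * r) = x * (y - p) + z * (w - r)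
            by intros; ring]
          refine (norm_add_le _ _).trans ?_
          rw [norm_mul, norm_mul, ← Complex.ofReal_mul, ← neg_mul, ← Complex.ofReal_neg,
            Complex.norm_exp_ofReal_mul_I, Complex.norm_exp_ofReal_mul_I, one_mul, one_mul]
    _ = 1 / 2 * ((∫ t in η..(η + 1), D t) + ∫ t in (η - 1)..η, D t) := by
        rw [intervalIntegral.integral_const_mul, intervalIntegral.integral_add hip him,
          hplus, hminus]
    _ ≤ _ := by
        have h1 := hsub η (η + 1) (by linarith) (by linarith) (by linarith)
        have h2 := hsub (η - 1) η (by linarith) (by linarith) (by linarith)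
        linarith

/-! ### Local limit theorem for nearly Gaussian laws -/

/-- The Gaussian law with standard deviation `s`. -/
noncomputable def centeredGaussian (s : ℝ) : Measure ℝ := gaussianReal 0 (Real.toNNReal (s ^ 2))

instance (s : ℝ) : IsProbabilityMeasure (centeredGaussian s) := by
  unfold centeredGaussian; infer_instance

theorem charFun_centeredGaussian (s ξ : ℝ) :
    charFun (centeredGaussian s) ξ = Complex.exp (-(s ^ 2 * ξ ^ 2 / 2 : ℝ)) := by
  rw [centeredGaussian, charFun_gaussianReal, Real.coe_toNNReal _ (sq_nonneg s)]
  congr 1; push_cast; ring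

/-- After multiplication by `s n * √(2π)` the Gaussian density is `exp(-(v / s n)² / 2)`, which is
at most `1` and tends to `1`: the limit is Lebesgue measure. -/
theorem tendsto_integral_centeredGaussian {s : ℕ → ℝ} (hs : Tendsto s atTop atTop) {f : ℝ → ℂ}
    (hf : Integrable f) :
    Tendsto (fun n => ((s n * √(2 * Real.pi) : ℝ) : ℂ) * ∫ v, f v ∂(centeredGaussian (s n))) atTop
      (𝓝 (∫ v, f v)) := by
  have h1 : (fun n => ∫ v, ((Real.exp (-(v / s n) ^ 2 / 2) : ℝ) : ℂ) * f v) =ᶠ[atTop]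
      (fun n => ((s n * √(2 * Real.pi) : ℝ) : ℂ) * ∫ v, f v ∂(centeredGaussian (s n))) := by
    filter_upwards [hs.eventually_gt_atTop 0] with n hn
    rw [centeredGaussian, integral_gaussianReal_eq_integral_smul
      (by rw [ne_eq, Real.toNNReal_eq_zero, not_le]; positivity), ← integral_const_mul]
    congr 1; ext v
    rw [gaussianPDFReal_def, Real.coe_toNNReal _ (sq_nonneg _), Complex.real_smul, ← mul_assoc,
      ← Complex.ofReal_mul]
    congr 2
    simp only [sub_zero]
    rw [Real.sqrt_mul (show 0 ≤ 2 * Real.pi by positivity) (s n ^ 2), Real.sqrt_sq hn.le,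
      mul_comm (√(2 * Real.pi)), ← mul_assoc, mul_inv_cancel₀ (by positivity), one_mul]
    congr 1; field_simp
  refine Tendsto.congr' h1 ?_
  refine tendsto_integral_filter_of_dominated_convergence (fun v => ‖f v‖) ?_ ?_ hf.norm ?_
  · refine Eventually.of_forall fun n => AEStronglyMeasurable.mul ?_ hf.aestronglyMeasurable
    exact Continuous.aestronglyMeasurable (by fun_prop)
  · refine Eventually.of_forall fun n => Eventually.of_forall fun v => ?_
    rw [norm_mul, Complex.norm_real, Real.norm_eq_abs, Real.abs_exp]
    refine mul_le_of_le_one_left (norm_nonneg _) (Real.exp_le_one_iff.2 ?_)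
    have := sq_nonneg (v / s n)
    linarith
  · refine Eventually.of_forall fun v => ?_
    have h2 : Tendsto (fun n => v / s n) atTop (𝓝 0) := hs.const_div_atTop v
    have h3 : Tendsto (fun n => Real.exp (-(v / s n) ^ 2 / 2)) atTop (𝓝 (Real.exp (-0 ^ 2 / 2))) :=
      (Real.continuous_exp.tendsto _).comp (((h2.pow 2).neg).div_const 2)
    have h4 := ((Complex.continuous_ofReal.tendsto _).comp h3).mul_const (f v)
    simpa using h4

/-- The characteristic functions `charFun (ν n)` are close to those of the Gaussian laws with
standard deviations `s n`, in a strong sense near the origin and up to a bounded factor on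
compact sets. -/
structure GaussianCharFun (ν : ℕ → Measure ℝ) (s : ℕ → ℝ) : Prop where
  tendsto_scale : Tendsto s atTop atTop
  bound : ∀ R : ℝ, ∃ C : ℝ, ∀ᶠ n in atTop, ∀ ξ : ℝ, |ξ| ≤ R →
    ‖charFun (ν n) ξ‖ ≤ C * Real.exp (-(s n ^ 2 * ξ ^ 2 / 2))
  tendsto_charFun : ∀ ξ : ℝ,
    Tendsto (fun n => charFun (ν n) (ξ / s n)) atTop (𝓝 (Complex.exp (-(ξ ^ 2 / 2 : ℝ))))

section Local

variable {ν : ℕ → Measure ℝ} {s : ℕ → ℝ} [∀ n, IsProbabilityMeasure (ν n)]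

/-- Substituting `ξ = x / s n` absorbs the factor `s n`; the integrand then tends to `0` and is
dominated by a multiple of `exp(-x² / 2)`. -/
theorem GaussianCharFun.tendsto_integral_charFun_sub (h : GaussianCharFun ν s) (R : ℝ) :
    Tendsto (fun n => s n * ∫ ξ in (-R)..R,
      ‖charFun (ν n) ξ - charFun (centeredGaussian (s n)) ξ‖) atTop (𝓝 0) := by
  obtain ⟨C, hC⟩ := h.bound |R|
  set D : ℕ → ℝ → ℝ := fun n ξ => ‖charFun (ν n) ξ - charFun (centeredGaussian (s n)) ξ‖ with hD
  have hDm : ∀ n, Measurable (D n) := fun n => (measurable_charFun.sub measurable_charFun).norm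
  -- The sign accounts for the orientation of the interval integral when `R < 0`.
  have h1 : ∀ᶠ n in atTop, (∫ x, (Set.uIoc (-R * s n) (R * s n)).indicator
      (fun x => D n (x / s n)) x) * (if -R ≤ R then 1 else -1)
      = s n * ∫ ξ in (-R)..R, D n ξ := by
    filter_upwards [h.tendsto_scale.eventually_gt_atTop 0] with n hn
    have e := intervalIntegral.integral_comp_div (a := -R * s n) (b := R * s n) (D n) hn.ne'
    rw [mul_div_cancel_right₀ _ hn.ne', mul_div_cancel_right₀ _ hn.ne', smul_eq_mul] at e
    rw [← e, integral_indicator measurableSet_uIoc, intervalIntegral.intervalIntegral_eq_integral_uIoc,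
      smul_eq_mul, mul_comm]
    congr 1
    simp only [mul_le_mul_iff_left₀ hn]
  refine Tendsto.congr' h1 ?_
  have hlim : ∀ x : ℝ, Tendsto (fun n => D n (x / s n)) atTop (𝓝 0) := by
    intro x
    have h2 := h.tendsto_charFun x
    have h3 : ∀ᶠ n in atTop, charFun (centeredGaussian (s n)) (x / s n)
        = Complex.exp (-(x ^ 2 / 2 : ℝ)) := by
      filter_upwards [h.tendsto_scale.eventually_gt_atTop 0] with n hn
      rw [charFun_centeredGaussian]
      congr 3; field_simp
    have h4 := (h2.sub (tendsto_const_nhds.congr' (EventuallyEq.symm h3))).norm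
    simpa using h4
  have key : Tendsto (fun n => ∫ x, (Set.uIoc (-R * s n) (R * s n)).indicator
      (fun x => D n (x / s n)) x) atTop (𝓝 (∫ _ : ℝ, (0 : ℝ))) := by
    refine tendsto_integral_filter_of_dominated_convergence
      (fun x => (C + 1) * Real.exp (-(1 / 2) * x ^ 2)) ?_ ?_
      ((integrable_exp_neg_mul_sq (by norm_num)).const_mul _) ?_
    · refine Eventually.of_forall fun n => Measurable.aestronglyMeasurable ?_
      exact ((hDm n).comp (measurable_id.div_const _)).indicator measurableSet_uIoc
    · filter_upwards [hC, h.tendsto_scale.eventually_gt_atTop 0] with n hn hsn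
      refine Eventually.of_forall fun x => ?_
      have h0 : (-(1 / 2) * x ^ 2 : ℝ) = -(s n ^ 2 * (x / s n) ^ 2 / 2) := by field_simp
      have hC0 : 0 ≤ C := by
        have := (norm_nonneg _).trans (hn 0 (by simp))
        simpa using this
      by_cases hx : x ∈ Set.uIoc (-R * s n) (R * s n)
      · rw [Set.indicator_of_mem hx, norm_norm, h0]
        have hx' : |x / s n| ≤ |R| := by
          have h7 : |R * s n| = |R| * s n := by rw [abs_mul, abs_of_pos hsn]
          rw [abs_div, abs_of_pos hsn, div_le_iff₀ hsn, ← h7]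
          rw [Set.mem_uIoc] at hx
          rw [abs_le]
          have h5 := le_abs_self (R * s n)
          have h6 := neg_abs_le (R * s n)
          rcases hx with hx | hx <;> constructor <;> linarith [hx.1, hx.2]
        refine (norm_sub_le _ _).trans ?_
        rw [add_mul, one_mul]
        refine add_le_add (hn _ hx') (le_of_eq ?_)
        rw [charFun_centeredGaussian, ← Complex.ofReal_neg, ← Complex.ofReal_exp, Complex.norm_real,
          Real.norm_eq_abs, Real.abs_exp]
      · rw [Set.indicator_of_notMem hx, norm_zero]; positivity
    · refine Eventually.of_forall fun x => ?_
      refine squeeze_zero_norm (fun n => ?_) (hlim x)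
      by_cases hx : x ∈ Set.uIoc (-R * s n) (R * s n)
      · rw [Set.indicator_of_mem hx, Real.norm_eq_abs, abs_of_nonneg (norm_nonneg _)]
      · rw [Set.indicator_of_notMem hx, norm_zero]; exact norm_nonneg _
  simpa using key.mul_const (if -R ≤ R then (1 : ℝ) else -1)

theorem GaussianCharFun.tendsto_integral_fejer (h : GaussianCharFun ν s) (b η : ℝ) :
    Tendsto (fun n => ((s n * √(2 * Real.pi) : ℝ) : ℂ) *
      ∫ v, (fejer (v + b) : ℂ) * Complex.exp (η * v * Complex.I) ∂(ν n)) atTop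
      (𝓝 (∫ v : ℝ, (fejer (v + b) : ℂ) * Complex.exp (η * v * Complex.I))) := by
  have hint : Integrable fun v : ℝ => (fejer (v + b) : ℂ) * Complex.exp (η * v * Complex.I) := by
    refine ((integrable_fejer.comp_add_right b).ofReal (𝕜 := ℂ)).mul_bdd (c := 1)
      (Continuous.aestronglyMeasurable (by fun_prop)) (Eventually.of_forall fun v => ?_)
    rw [← Complex.ofReal_mul, Complex.norm_exp_ofReal_mul_I]
  have h1 := tendsto_integral_centeredGaussian h.tendsto_scale hint
  have h2 := (h.tendsto_integral_charFun_sub (|η| + 1)).const_mul √(2 * Real.pi)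
  rw [mul_zero] at h2
  rw [← tendsto_sub_nhds_zero_iff] at h1 ⊢
  have h3 : Tendsto (fun n => ((s n * √(2 * Real.pi) : ℝ) : ℂ) *
      (∫ v, (fejer (v + b) : ℂ) * Complex.exp (η * v * Complex.I) ∂(ν n))
      - ((s n * √(2 * Real.pi) : ℝ) : ℂ) *
      ∫ v, (fejer (v + b) : ℂ) * Complex.exp (η * v * Complex.I) ∂(centeredGaussian (s n))) atTop
      (𝓝 0) := by
    refine squeeze_zero_norm' ?_ h2
    filter_upwards [h.tendsto_scale.eventually_gt_atTop 0] with n hn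
    rw [← mul_sub, norm_mul, Complex.norm_real, Real.norm_eq_abs, abs_of_pos (by positivity)]
    have := norm_integral_fejer_sub_le (ν n) (centeredGaussian (s n)) b η le_rfl
    calc _ ≤ s n * √(2 * Real.pi) * _ := mul_le_mul_of_nonneg_left this (by positivity)
      _ = _ := by ring
  have h4 := h3.add h1
  simpa using h4

theorem GaussianCharFun.tendsto_integral_posKernel (h : GaussianCharFun ν s) (η : ℝ) :
    Tendsto (fun n => ((s n * √(2 * Real.pi) : ℝ) : ℂ) *
      ∫ v, (posKernel v : ℂ) * Complex.exp (η * v * Complex.I) ∂(ν n)) atTop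
      (𝓝 (∫ v : ℝ, (posKernel v : ℂ) * Complex.exp (η * v * Complex.I))) := by
  have h1 := (h.tendsto_integral_fejer 0 η).add (h.tendsto_integral_fejer Real.pi η)
  have hb : ∀ (b : ℝ), AEStronglyMeasurable
      (fun v : ℝ => (fejer (v + b) : ℂ)) volume ∧ ∀ v : ℝ, ‖(fejer (v + b) : ℂ)‖ ≤ 1 := by
    intro b
    refine ⟨Continuous.aestronglyMeasurable ?_, fun v => ?_⟩
    · exact Complex.continuous_ofReal.comp (continuous_fejer.comp (by fun_prop))
    · rw [Complex.norm_real, Real.norm_eq_abs, abs_of_nonneg (fejer_nonneg _)]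
      exact fejer_le_one _
  have hvol : ∀ b : ℝ, Integrable
      (fun v : ℝ => (fejer (v + b) : ℂ) * Complex.exp (η * v * Complex.I)) := fun b => by
    refine ((integrable_fejer.comp_add_right b).ofReal (𝕜 := ℂ)).mul_bdd (c := 1)
      (Continuous.aestronglyMeasurable (by fun_prop)) (Eventually.of_forall fun v => ?_)
    rw [← Complex.ofReal_mul, Complex.norm_exp_ofReal_mul_I]
  have hν : ∀ (n : ℕ) (b : ℝ), Integrable
      (fun v : ℝ => (fejer (v + b) : ℂ) * Complex.exp (η * v * Complex.I)) (ν n) := fun n b => by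
    refine Integrable.of_bound (C := 1) (Continuous.aestronglyMeasurable ?_)
      (Eventually.of_forall fun v => ?_)
    · exact (Complex.continuous_ofReal.comp (continuous_fejer.comp (by fun_prop))).mul (by fun_prop)
    · rw [norm_mul, ← Complex.ofReal_mul, Complex.norm_exp_ofReal_mul_I, mul_one]
      exact (hb b).2 v
  have e : ∀ v : ℝ, (posKernel v : ℂ) * Complex.exp (η * v * Complex.I)
      = (fejer (v + 0) : ℂ) * Complex.exp (η * v * Complex.I)
        + (fejer (v + Real.pi) : ℂ) * Complex.exp (η * v * Complex.I) := fun v => by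
    rw [posKernel, add_zero]; push_cast; ring
  simp_rw [e]
  rw [integral_add (hvol 0) (hvol _)]
  refine h1.congr fun n => ?_
  rw [integral_add (hν n 0) (hν n _), mul_add]

/-- Tilting by `log F` reweights by `F / ∫ F`. This also turns Lebesgue measure into a probability
measure when `F` is integrable. -/
theorem charFun_tilted_log {μ : Measure ℝ} {F : ℝ → ℝ} (hF : ∀ v, 0 < F v) (η : ℝ) :
    charFun (μ.tilted fun v => Real.log (F v)) η
      = (∫ v, (F v : ℂ) * Complex.exp (η * v * Complex.I) ∂μ) / (∫ v, F v ∂μ : ℝ) := by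
  rw [charFun_apply_real, integral_tilted, ← integral_div]
  congr 1; ext v
  simp_rw [Real.exp_log (hF _)]
  rw [Complex.real_smul]; push_cast; ring

theorem integral_tilted_log {μ : Measure ℝ} {F : ℝ → ℝ} (hF : ∀ v, 0 < F v) (g : ℝ → ℝ) :
    ∫ v, g v ∂(μ.tilted fun v => Real.log (F v)) = (∫ v, F v * g v ∂μ) / ∫ v, F v ∂μ := by
  rw [integral_tilted, ← integral_div]
  congr 1; ext v
  simp_rw [Real.exp_log (hF _)]
  rw [smul_eq_mul]; ring

theorem posKernel_integrable_of_isProbabilityMeasure (μ : Measure ℝ) [IsProbabilityMeasure μ] :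
    Integrable posKernel μ := by
  refine Integrable.of_bound (C := 2) continuous_posKernel.aestronglyMeasurable
    (Eventually.of_forall fun v => ?_)
  rw [Real.norm_eq_abs, abs_of_pos (posKernel_pos v), posKernel]
  linarith [fejer_le_one v, fejer_le_one (v + Real.pi)]

/-- Reweighting by `posKernel` turns the scaled measures into probability measures whose
characteristic functions converge, so Lévy's theorem applies. The test function becomes `φ /
posKernel`, bounded by `exp_neg_abs_le`. -/
theorem GaussianCharFun.tendsto_integral_of_exp_decay (h : GaussianCharFun ν s) {φ : ℝ → ℝ}
    (hφ : Continuous φ) {K : ℝ} (hK : ∀ v, |φ v| ≤ K * Real.exp (-|v|)) :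
    Tendsto (fun n => s n * √(2 * Real.pi) * ∫ v, φ v ∂(ν n)) atTop (𝓝 (∫ v, φ v)) := by
  set c : ℕ → ℝ := fun n => s n * √(2 * Real.pi) with hc
  have hcpos : ∀ᶠ n in atTop, 0 < c n := by
    filter_upwards [h.tendsto_scale.eventually_gt_atTop 0] with n hn
    positivity
  set lF : ℝ → ℝ := fun v => Real.log (posKernel v) with hlF
  have hexp : (fun v => Real.exp (lF v)) = posKernel := by
    ext v; exact Real.exp_log (posKernel_pos v)
  have hp : ∀ n, IsProbabilityMeasure ((ν n).tilted lF) := fun n =>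
    isProbabilityMeasure_tilted (by rw [hexp]; exact posKernel_integrable_of_isProbabilityMeasure _)
  have hp0 : IsProbabilityMeasure ((volume : Measure ℝ).tilted lF) :=
    isProbabilityMeasure_tilted (by rw [hexp]; exact integrable_posKernel)
  set μ : ℕ → ProbabilityMeasure ℝ := fun n => ⟨(ν n).tilted lF, hp n⟩ with hμ
  set μ₀ : ProbabilityMeasure ℝ := ⟨(volume : Measure ℝ).tilted lF, hp0⟩ with hμ₀
  have hF0 : 0 < ∫ v, posKernel v := by
    have := integral_exp_pos (f := lF) (μ := (volume : Measure ℝ))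
      (by rw [hexp]; exact integrable_posKernel)
    rwa [hexp] at this
  have hmass : Tendsto (fun n => c n * ∫ v, posKernel v ∂(ν n)) atTop (𝓝 (∫ v, posKernel v)) := by
    have h1 := h.tendsto_integral_posKernel 0
    simp only [Complex.ofReal_zero, zero_mul, Complex.exp_zero, mul_one] at h1
    simp_rw [integral_complex_ofReal] at h1
    have h2 := (Complex.continuous_re.tendsto _).comp h1
    refine (h2.congr fun n => ?_)
    simp only [Function.comp]
    rw [← Complex.ofReal_mul, Complex.ofReal_re]
  have hlim : Tendsto μ atTop (𝓝 μ₀) := by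
    refine ProbabilityMeasure.tendsto_of_tendsto_charFun fun η => ?_
    have h1 := (h.tendsto_integral_posKernel η).div
      ((Complex.continuous_ofReal.tendsto _).comp hmass) (by exact_mod_cast hF0.ne')
    simp only [hμ, hμ₀, ProbabilityMeasure.coe_mk, hlF, charFun_tilted_log posKernel_pos]
    refine h1.congr' ?_
    filter_upwards [hcpos] with n hn
    simp only [Pi.div_apply, Function.comp]
    rw [Complex.ofReal_mul (c n), mul_div_mul_left _ _ (by exact_mod_cast hn.ne')]
  have hbd : ∀ v, ‖φ v / posKernel v‖ ≤ K * Real.exp Real.pi := by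
    intro v
    have h1 := exp_neg_abs_le v
    have h2 := posKernel_pos v
    have hK0 : 0 ≤ K := by
      have := (abs_nonneg _).trans (hK 0)
      simpa using this
    rw [norm_div, Real.norm_eq_abs, Real.norm_eq_abs, abs_of_pos h2, div_le_iff₀ h2]
    calc |φ v| ≤ K * Real.exp (-|v|) := hK v
      _ ≤ K * (Real.exp Real.pi * posKernel v) := by gcongr
      _ = _ := by ring
  set g : ℝ →ᵇ ℝ := BoundedContinuousFunction.ofNormedAddCommGroup (fun v => φ v / posKernel v)
    (hφ.div continuous_posKernel fun v => (posKernel_pos v).ne') _ hbd with hg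
  have h2 := (ProbabilityMeasure.tendsto_iff_forall_integral_tendsto.1 hlim g).mul hmass
  have hgφ : ∀ v, posKernel v * g v = φ v := fun v => by
    simp only [hg, BoundedContinuousFunction.coe_ofNormedAddCommGroup]
    rw [mul_div_cancel₀ _ (posKernel_pos v).ne']
  simp only [hμ, hμ₀, ProbabilityMeasure.coe_mk, hlF, integral_tilted_log posKernel_pos, hgφ] at h2
  rw [div_mul_cancel₀ _ hF0.ne'] at h2
  refine h2.congr fun n => ?_
  have h3 : 0 < ∫ v, posKernel v ∂(ν n) := by
    have := integral_exp_pos (f := lF) (μ := ν n)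
      (by rw [hexp]; exact posKernel_integrable_of_isProbabilityMeasure _)
    rwa [hexp] at this
  rw [div_mul_eq_mul_div, mul_left_comm, ← mul_assoc, mul_div_cancel_right₀ _ h3.ne']

/-- The ramp approximations of `exp (-v)` on `v ≥ 0`. -/
noncomputable def expRamp (a ε v : ℝ) : ℝ := Real.exp (-v) * min 1 (max 0 ((v + a) / ε))

theorem continuous_expRamp (a ε : ℝ) : Continuous (expRamp a ε) := by
  unfold expRamp; fun_prop

theorem expRamp_nonneg (a ε v : ℝ) : 0 ≤ expRamp a ε v := by
  unfold expRamp; positivity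

theorem expRamp_le (a ε v : ℝ) : expRamp a ε v ≤ Real.exp (-v) :=
  mul_le_of_le_one_right (Real.exp_pos _).le (min_le_left _ _)

theorem expRamp_eq_zero {a ε v : ℝ} (hε : 0 < ε) (hv : v ≤ -a) : expRamp a ε v = 0 := by
  have : (v + a) / ε ≤ 0 := div_nonpos_of_nonpos_of_nonneg (by linarith) hε.le
  rw [expRamp, max_eq_left this]; simp

theorem expRamp_eq_exp {a ε v : ℝ} (hε : 0 < ε) (hv : ε - a ≤ v) :
    expRamp a ε v = Real.exp (-v) := by
  have : 1 ≤ (v + a) / ε := by rw [le_div_iff₀ hε]; linarith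
  rw [expRamp, max_eq_right (by linarith), min_eq_left this, mul_one]

theorem abs_expRamp_le {a ε : ℝ} (ha : 0 ≤ a) (hε : 0 < ε) (v : ℝ) :
    |expRamp a ε v| ≤ Real.exp (2 * a) * Real.exp (-|v|) := by
  rw [abs_of_nonneg (expRamp_nonneg _ _ _)]
  rcases le_total v (-a) with hv | hv
  · rw [expRamp_eq_zero hε hv]; positivity
  · refine (expRamp_le _ _ _).trans ?_
    rw [← Real.exp_add, Real.exp_le_exp]
    rcases abs_cases v with h | h <;> linarith [h.1]

theorem integrable_expRamp {a ε : ℝ} (ha : 0 ≤ a) (hε : 0 < ε) (μ : Measure ℝ)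
    [IsProbabilityMeasure μ] : Integrable (expRamp a ε) μ := by
  refine Integrable.of_bound (C := Real.exp (2 * a)) (continuous_expRamp _ _).aestronglyMeasurable
    (Eventually.of_forall fun v => (abs_expRamp_le ha hε v).trans ?_)
  exact mul_le_of_le_one_right (Real.exp_pos _).le (Real.exp_le_one_iff.2 (by simp))

theorem integral_expRamp_le {a ε : ℝ} (hε : 0 < ε) : ∫ v, expRamp a ε v ≤ Real.exp a := by
  have h1 : ∫ v, expRamp a ε v ≤ ∫ v, (Set.Ioi (-a)).indicator (fun v => Real.exp (-v)) v := by
    refine integral_mono_of_nonneg (Eventually.of_forall (expRamp_nonneg a ε)) ?_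
      (Eventually.of_forall fun v => ?_)
    · exact IntegrableOn.integrable_indicator (integrableOn_exp_neg_Ioi _) measurableSet_Ioi
    · by_cases hv : v ∈ Set.Ioi (-a)
      · rw [Set.indicator_of_mem hv]; exact expRamp_le _ _ _
      · rw [Set.indicator_of_notMem hv, expRamp_eq_zero hε (by simpa using hv)]
  rwa [integral_indicator measurableSet_Ioi, integral_exp_neg_Ioi, neg_neg] at h1

theorem le_integral_expRamp {a ε : ℝ} (hε : 0 < ε) :
    Real.exp (a - ε) ≤ ∫ v, expRamp a ε v := by
  have h1 : ∫ v, (Set.Ioi (ε - a)).indicator (fun v => Real.exp (-v)) v ≤ ∫ v, expRamp a ε v := by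
    refine integral_mono_of_nonneg (Eventually.of_forall fun v => ?_) ?_
      (Eventually.of_forall fun v => ?_)
    · exact Set.indicator_nonneg (fun v _ => (Real.exp_pos _).le) v
    · have hmaj : Integrable ((Set.Ioi (-a)).indicator fun v : ℝ => Real.exp (-v)) :=
        IntegrableOn.integrable_indicator (integrableOn_exp_neg_Ioi _) measurableSet_Ioi
      refine hmaj.mono' (continuous_expRamp _ _).aestronglyMeasurable
        (Eventually.of_forall fun v => ?_)
      rw [Real.norm_eq_abs, abs_of_nonneg (expRamp_nonneg _ _ _)]
      by_cases hv : v ∈ Set.Ioi (-a)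
      · rw [Set.indicator_of_mem hv]; exact expRamp_le _ _ _
      · rw [Set.indicator_of_notMem hv, expRamp_eq_zero hε (by simpa using hv)]
    · by_cases hv : v ∈ Set.Ioi (ε - a)
      · rw [Set.indicator_of_mem hv, expRamp_eq_exp hε (le_of_lt hv)]
      · rw [Set.indicator_of_notMem hv]; exact expRamp_nonneg _ _ _
  rwa [integral_indicator measurableSet_Ioi, integral_exp_neg_Ioi, neg_sub] at h1

/-- The jump at `0` is squeezed between the ramps starting at `0` and at `-ε`, whose integrals lie
between `exp(-ε)` and `exp ε`. -/
theorem GaussianCharFun.tendsto_integral_exp_neg (h : GaussianCharFun ν s) :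
    Tendsto (fun n => s n * √(2 * Real.pi) *
      ∫ v, (Set.Ici 0).indicator (fun v => Real.exp (-v)) v ∂(ν n)) atTop (𝓝 1) := by
  set f : ℝ → ℝ := (Set.Ici 0).indicator (fun v => Real.exp (-v)) with hf
  have hfi : ∀ n, Integrable f (ν n) := fun n => by
    refine Integrable.of_bound (C := 1)
      ((Continuous.measurable (by fun_prop)).indicator measurableSet_Ici).aestronglyMeasurable
      (Eventually.of_forall fun v => ?_)
    by_cases hv : v ∈ Set.Ici (0 : ℝ)
    · rw [hf, Set.indicator_of_mem hv, Real.norm_eq_abs, Real.abs_exp]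
      exact Real.exp_le_one_iff.2 (by simpa using hv)
    · rw [hf, Set.indicator_of_notMem hv]; simp
  have hlow : ∀ ε, 0 < ε → ∀ v, expRamp 0 ε v ≤ f v := fun ε hε v => by
    by_cases hv : v ∈ Set.Ici (0 : ℝ)
    · rw [hf, Set.indicator_of_mem hv]; exact expRamp_le _ _ _
    · rw [hf, Set.indicator_of_notMem hv,
        expRamp_eq_zero hε (by simp only [Set.mem_Ici, not_le] at hv; linarith)]
  have hupp : ∀ ε, 0 < ε → ∀ v, f v ≤ expRamp ε ε v := fun ε hε v => by
    by_cases hv : v ∈ Set.Ici (0 : ℝ)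
    · rw [hf, Set.indicator_of_mem hv, expRamp_eq_exp hε (by simpa using hv)]
    · rw [hf, Set.indicator_of_notMem hv]; exact expRamp_nonneg _ _ _
  have hlimε : ∀ (σ : ℝ), Tendsto (fun ε : ℝ => Real.exp (σ * ε)) (𝓝[>] 0) (𝓝 1) := fun σ => by
    have : Tendsto (fun ε : ℝ => Real.exp (σ * ε)) (𝓝 0) (𝓝 (Real.exp (σ * 0))) :=
      Continuous.tendsto (by fun_prop) 0
    rw [mul_zero, Real.exp_zero] at this
    exact this.mono_left nhdsWithin_le_nhds
  rw [tendsto_order]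
  constructor
  · intro a ha
    obtain ⟨ε, h1, hε⟩ := (((hlimε (-1)).eventually_const_lt ha).and self_mem_nhdsWithin).exists
    have hε : 0 < ε := hε
    have h2 := h.tendsto_integral_of_exp_decay (continuous_expRamp 0 ε) (abs_expRamp_le le_rfl hε)
    have h3 := le_integral_expRamp (a := 0) hε
    filter_upwards [h2.eventually_const_lt (show a < _ by
        refine lt_of_lt_of_le h1 (le_trans (le_of_eq ?_) h3); congr 1; ring),
      h.tendsto_scale.eventually_gt_atTop 0] with n hn hsn
    refine hn.trans_le (mul_le_mul_of_nonneg_left ?_ (by positivity))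
    exact integral_mono (integrable_expRamp le_rfl hε _) (hfi n) (hlow ε hε)
  · intro a ha
    obtain ⟨ε, h1, hε⟩ := (((hlimε 1).eventually_lt_const ha).and self_mem_nhdsWithin).exists
    have hε : 0 < ε := hε
    have h2 := h.tendsto_integral_of_exp_decay (continuous_expRamp ε ε) (abs_expRamp_le hε.le hε)
    have h3 := integral_expRamp_le (a := ε) hε
    filter_upwards [h2.eventually_lt_const (show _ < a by
        refine lt_of_le_of_lt (h3.trans (le_of_eq ?_)) h1; congr 1; ring),
      h.tendsto_scale.eventually_gt_atTop 0] with n hn hsn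
    refine lt_of_le_of_lt (mul_le_mul_of_nonneg_left ?_ (by positivity)) hn
    exact integral_mono (hfi n) (integrable_expRamp hε.le hε _) (hupp ε hε)

end Local

/-! ### Tail estimates from mod-Gaussian convergence -/

/-- The renormalised moment generating function, which tends to `1` under mod-Gaussian
convergence. -/
noncomputable def residue (P : ℕ → Measure ℝ) (A : ℕ → ℝ) (κ : ℝ) (n : ℕ) (z : ℂ) : ℂ :=
  complexMGF id (P n) z * Complex.exp (-(A n ^ 2 * z ^ 2 / 2) + κ * z ^ 4 / 12)

section ModGaussian

variable {P : ℕ → Measure ℝ} {A : ℕ → ℝ} {κ : ℝ}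

theorem complexMGF_eq_residue_mul (n : ℕ) (z : ℂ) : complexMGF id (P n) z
    = residue P A κ n z * Complex.exp (A n ^ 2 * z ^ 2 / 2 - κ * z ^ 4 / 12) := by
  rw [residue, mul_assoc, ← Complex.exp_add]
  ring_nf
  simp

theorem IsModGaussian.comp (h : IsModGaussian P A κ) {φ : ℕ → ℕ} (hφ : Tendsto φ atTop atTop) :
    IsModGaussian (P ∘ φ) (A ∘ φ) κ :=
  fun R ε hε => hφ.eventually (h R ε hε)

theorem IsModGaussian.tendsto_residue (h : IsModGaussian P A κ) {z : ℕ → ℂ} {R : ℝ}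
    (hz : ∀ᶠ n in atTop, ‖z n‖ ≤ R) :
    Tendsto (fun n => residue P A κ n (z n)) atTop (𝓝 1) := by
  rw [Metric.tendsto_nhds]
  intro ε hε
  filter_upwards [h R (ε / 2) (by positivity), hz] with n h1 h2
  rw [dist_eq_norm]
  exact (h1 _ h2).trans_lt (by linarith)

/-- The law, rescaled by `h` and centred at `A ^ 2 * h`, of the exponential tilting of a measure. -/
noncomputable def tiltedLaw (μ : Measure ℝ) (A h : ℝ) : Measure ℝ :=
  (μ.tilted fun x => h * x).map fun x => h * (x - A ^ 2 * h)

theorem isProbabilityMeasure_tiltedLaw {μ : Measure ℝ} [IsProbabilityMeasure μ] (A : ℝ) {h : ℝ}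
    (hi : Integrable (fun x => Real.exp (h * x)) μ) : IsProbabilityMeasure (tiltedLaw μ A h) := by
  have := isProbabilityMeasure_tilted hi
  exact Measure.isProbabilityMeasure_map (by fun_prop)

theorem charFun_tiltedLaw {μ : Measure ℝ} (A h ξ : ℝ) :
    charFun (tiltedLaw μ A h) ξ
      = complexMGF id μ (h * (1 + ξ * Complex.I)) / complexMGF id μ h
        * Complex.exp (-((h * A) ^ 2 * ξ * Complex.I)) := by
  rw [charFun_apply_real, tiltedLaw, integral_map (by fun_prop)
    (Continuous.aestronglyMeasurable (by fun_prop)), integral_tilted, complexMGF, div_mul_eq_mul_div,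
    ← integral_mul_const, complexMGF_ofReal, ← integral_div]
  congr 1; ext x
  rw [Complex.real_smul, ← Complex.exp_add]
  simp only [mgf, id]
  push_cast
  rw [div_mul_eq_mul_div, ← Complex.exp_add]
  congr 2; ring

/-- Cramér's change of measure: undoing the tilt at `x` costs `mgf * exp(-h x)`, and `h x = (h A)² +
v` in the centred variable `v`. -/
theorem measureReal_Ici_eq {μ : Measure ℝ} [IsProbabilityMeasure μ] (A h : ℝ) (hpos : 0 < h)
    (hi : Integrable (fun x => Real.exp (h * x)) μ) :
    μ.real (Set.Ici (A ^ 2 * h)) = mgf id μ h * Real.exp (-(h * A) ^ 2) *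
      ∫ v, (Set.Ici 0).indicator (fun v => Real.exp (-v)) v ∂(tiltedLaw μ A h) := by
  have hm : 0 < mgf id μ h := mgf_pos hi
  rw [tiltedLaw, integral_map (by fun_prop)
    ((Continuous.measurable (by fun_prop)).indicator measurableSet_Ici).aestronglyMeasurable,
    integral_tilted, ← integral_const_mul, ← integral_indicator_one measurableSet_Ici]
  congr 1; ext x
  by_cases hx : x ∈ Set.Ici (A ^ 2 * h)
  · have hx' : h * (x - A ^ 2 * h) ∈ Set.Ici (0 : ℝ) := by
      simp only [Set.mem_Ici] at hx ⊢
      exact mul_nonneg hpos.le (by linarith)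
    rw [Set.indicator_of_mem hx, Set.indicator_of_mem hx', smul_eq_mul, Pi.one_apply]
    have e : (∫ x, Real.exp (h * x) ∂μ) = mgf id μ h := rfl
    rw [e]
    have : Real.exp (-(h * A) ^ 2) * Real.exp (h * x) * Real.exp (-(h * (x - A ^ 2 * h))) = 1 := by
      rw [← Real.exp_add, ← Real.exp_add, Real.exp_eq_one_iff]; ring
    rw [show ∀ m a b c : ℝ, m * a * (b / m * c) = (m / m) * (a * b * c) by intros; ring,
      div_self hm.ne', one_mul, this]
  · have hx' : h * (x - A ^ 2 * h) ∉ Set.Ici (0 : ℝ) := by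
      simp only [Set.mem_Ici, not_le] at hx ⊢
      exact mul_neg_of_pos_of_neg hpos (by linarith)
    rw [Set.indicator_of_notMem hx, Set.indicator_of_notMem hx']
    simp

/-- In `(h A)² ((1 + iξ)² - 1) / 2 = (h A)² (iξ - ξ² / 2)` the linear term is cancelled by the
centring, which leaves the Gaussian factor. -/
theorem charFun_tiltedLaw_eq (n : ℕ) (h ξ : ℝ) :
    charFun (tiltedLaw (P n) (A n) h) ξ
      = residue P A κ n (h * (1 + ξ * Complex.I)) / residue P A κ n h
        * Complex.exp (-(κ * h ^ 4 * ((1 + ξ * Complex.I) ^ 4 - 1) / 12))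
        * Complex.exp (-((h * A n) ^ 2 * ξ ^ 2 / 2 : ℝ)) := by
  rw [charFun_tiltedLaw, complexMGF_eq_residue_mul (A := A) (κ := κ),
    complexMGF_eq_residue_mul (A := A) (κ := κ) n h, mul_div_mul_comm, ← Complex.exp_sub,
    mul_assoc (_ / _), mul_assoc (_ / _), ← Complex.exp_add, ← Complex.exp_add]
  congr 2
  push_cast
  have hI := Complex.I_sq
  linear_combination ((A n : ℂ) ^ 2 * h ^ 2 * ξ ^ 2 / 2) * hI

/-- Only `h n * A n → ∞` is required, so `h₀ = 0` is allowed; this serves both constant tilts and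
tilts `y n / A n`. -/
theorem IsModGaussian.gaussianCharFun (hMG : IsModGaussian P A κ) {h : ℕ → ℝ} {h₀ : ℝ}
    (hh : Tendsto h atTop (𝓝 h₀)) (hs : Tendsto (fun n => h n * A n) atTop atTop) :
    GaussianCharFun (fun n => tiltedLaw (P n) (A n) (h n)) (fun n => h n * A n) := by
  have hH : ∀ᶠ n in atTop, |h n| ≤ |h₀| + 1 :=
    (hh.abs.eventually_lt_const (lt_add_one _)).mono fun _ => le_of_lt
  have hz : ∀ (n : ℕ) (ξ R : ℝ), |h n| ≤ |h₀| + 1 → |ξ| ≤ R →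
      ‖(h n : ℂ) * (1 + ξ * Complex.I)‖ ≤ (|h₀| + 1) * (1 + R) := by
    intro n ξ R h1 h2
    rw [norm_mul, Complex.norm_real, Real.norm_eq_abs]
    refine mul_le_mul h1 ((norm_add_le _ _).trans ?_) (norm_nonneg _) (by positivity)
    simpa using h2
  refine ⟨hs, fun R => ?_, fun ξ => ?_⟩
  · set E : ℝ := Real.exp (|κ| * (|h₀| + 1) ^ 4 * ((1 + |R|) ^ 4 + 1) / 12) with hE
    -- Residues within `1/2` of `1` have quotient at most `2 / (1/2)` in norm; `E` bounds the
    -- quartic exponential.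
    refine ⟨2 / (1 / 2) * E, ?_⟩
    filter_upwards [hH, hMG ((|h₀| + 1) * (1 + |R|)) (1 / 2) (by norm_num)] with n hn hW ξ hξ
    have hξ' : |ξ| ≤ |R| := hξ.trans (le_abs_self R)
    have h1 := hW _ (hz n ξ _ hn hξ')
    have h2 := hW (h n) (by
      have := hz n 0 |R| hn (by simp)
      simpa using this)
    have h3 : ‖residue P A κ n (h n * (1 + ξ * Complex.I))‖ ≤ 2 := by
      have := norm_le_norm_add_norm_sub' (residue P A κ n (h n * (1 + ξ * Complex.I))) 1
      rw [norm_one] at this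
      rw [residue] at this ⊢
      linarith
    have h4 : 1 / 2 ≤ ‖residue P A κ n (h n)‖ := by
      have := norm_le_norm_add_norm_sub (residue P A κ n (h n)) 1
      rw [norm_one] at this
      rw [residue] at this ⊢
      linarith
    rw [charFun_tiltedLaw_eq (κ := κ), norm_mul, norm_mul, norm_div]
    have h5 : ‖Complex.exp (-(κ * h n ^ 4 * ((1 + ξ * Complex.I) ^ 4 - 1) / 12))‖ ≤ E := by
      rw [Complex.norm_exp, hE, Real.exp_le_exp]
      refine (Complex.re_le_norm _).trans ?_
      rw [norm_neg, norm_div, norm_mul, norm_mul, norm_pow, Complex.norm_real, Complex.norm_real,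
        Real.norm_eq_abs, Real.norm_eq_abs]
      have h6 : ‖(1 + ξ * Complex.I) ^ 4 - 1‖ ≤ (1 + |R|) ^ 4 + 1 := by
        refine (norm_sub_le _ _).trans ?_
        rw [norm_pow, norm_one]
        have : ‖(1 + ξ * Complex.I)‖ ≤ 1 + |R| := by
          refine (norm_add_le _ _).trans ?_
          simpa using hξ'
        gcongr
      norm_num
      gcongr
    have h7 : ‖Complex.exp (-((h n * A n) ^ 2 * ξ ^ 2 / 2 : ℝ))‖
        = Real.exp (-((h n * A n) ^ 2 * ξ ^ 2 / 2)) := by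
      rw [← Complex.ofReal_neg, ← Complex.ofReal_exp, Complex.norm_real, Real.norm_eq_abs,
        Real.abs_exp]
    rw [h7]
    gcongr
  · have hξ0 : Tendsto (fun n => ξ / (h n * A n)) atTop (𝓝 0) := hs.const_div_atTop ξ
    have h1 : Tendsto (fun n => residue P A κ n (h n * (1 + (ξ / (h n * A n) : ℝ) * Complex.I)))
        atTop (𝓝 1) := by
      refine hMG.tendsto_residue (R := (|h₀| + 1) * (1 + 1)) ?_
      have h2 : ∀ᶠ n in atTop, |ξ / (h n * A n)| ≤ 1 := by
        have := hξ0.abs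
        rw [abs_zero] at this
        exact this.eventually_le_const zero_lt_one
      filter_upwards [hH, h2] with n hn1 hn2
      exact hz n _ _ hn1 hn2
    have h2 : Tendsto (fun n => residue P A κ n (h n)) atTop (𝓝 1) := by
      refine hMG.tendsto_residue (R := |h₀| + 1) ?_
      filter_upwards [hH] with n hn
      rwa [Complex.norm_real]
    have h3 : Tendsto (fun n => Complex.exp
        (-(κ * h n ^ 4 * ((1 + (ξ / (h n * A n) : ℝ) * Complex.I) ^ 4 - 1) / 12))) atTop
        (𝓝 (Complex.exp (-(κ * h₀ ^ 4 * ((1 + (0 : ℝ) * Complex.I) ^ 4 - 1) / 12)))) := by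
      have c1 := (Complex.continuous_ofReal.tendsto _).comp hh
      have c2 := (Complex.continuous_ofReal.tendsto _).comp hξ0
      exact (Complex.continuous_exp.tendsto _).comp
        ((((c1.pow 4).const_mul (κ : ℂ)).mul
          ((((c2.mul_const Complex.I).const_add 1).pow 4).sub_const 1)).div_const 12).neg
    have h4 := (h1.div h2 one_ne_zero).mul h3
    simp only [Complex.ofReal_zero, zero_mul, add_zero, one_pow, sub_self, mul_zero, zero_div,
      neg_zero, Complex.exp_zero, mul_one, div_one] at h4
    have h5 := h4.mul_const (Complex.exp (-(ξ ^ 2 / 2 : ℝ)))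
    rw [one_mul] at h5
    refine h5.congr' ?_
    filter_upwards [hs.eventually_gt_atTop 0] with n hn
    rw [charFun_tiltedLaw_eq (κ := κ)]
    congr 4
    rw [div_pow, mul_div_cancel₀ _ (by positivity)]

variable [∀ n, IsProbabilityMeasure (P n)]

/-- Precise moderate deviations under mod-Gaussian convergence. -/
theorem IsModGaussian.tendsto_tail (hMG : IsModGaussian P A κ)
    (hi : ∀ n t, Integrable (fun x => Real.exp (t * x)) (P n)) {h : ℕ → ℝ} {h₀ : ℝ}
    (hpos : ∀ᶠ n in atTop, 0 < h n)
    (hh : Tendsto h atTop (𝓝 h₀)) (hs : Tendsto (fun n => h n * A n) atTop atTop) :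
    Tendsto (fun n => (h n * A n) * √(2 * Real.pi) * Real.exp ((h n * A n) ^ 2 / 2) *
      (P n).real (Set.Ici (A n ^ 2 * h n))) atTop (𝓝 (Real.exp (-(κ * h₀ ^ 4 / 12)))) := by
  have := fun n => isProbabilityMeasure_tiltedLaw (A n) (hi n (h n))
  have h1 := (hMG.gaussianCharFun hh hs).tendsto_integral_exp_neg
  have h2 : Tendsto (fun n => mgf id (P n) (h n) * Real.exp (-((h n * A n) ^ 2 / 2))) atTop
      (𝓝 (Real.exp (-(κ * h₀ ^ 4 / 12)))) := by
    have h3 : Tendsto (fun n => residue P A κ n (h n)) atTop (𝓝 1) := by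
      refine hMG.tendsto_residue (R := |h₀| + 1) ?_
      filter_upwards [hh.abs.eventually_lt_const (lt_add_one _)] with n hn
      rw [Complex.norm_real]; exact hn.le
    have h4 : Tendsto (fun n => Real.exp (-(κ * h n ^ 4 / 12))) atTop
        (𝓝 (Real.exp (-(κ * h₀ ^ 4 / 12)))) :=
      (Real.continuous_exp.tendsto _).comp (((hh.pow 4).const_mul κ).div_const 12).neg
    have h5 := (Complex.continuous_re.tendsto _).comp
      (h3.mul ((Complex.continuous_ofReal.tendsto _).comp h4))
    rw [one_mul, Complex.ofReal_re] at h5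
    refine h5.congr fun n => ?_
    simp only [Function.comp]
    rw [← Complex.ofReal_re (mgf id (P n) (h n) * _), Complex.ofReal_mul, ← complexMGF_ofReal,
      complexMGF_eq_residue_mul (A := A) (κ := κ), mul_assoc, Complex.ofReal_exp,
      Complex.ofReal_exp, ← Complex.exp_add]
    congr 3; push_cast; ring
  have h6 := h1.mul h2
  rw [one_mul] at h6
  refine h6.congr' ?_
  filter_upwards [hpos] with n hn
  rw [measureReal_Ici_eq _ _ hn (hi n _)]
  have e : Real.exp (-((h n * A n) ^ 2 / 2)) = Real.exp ((h n * A n) ^ 2 / 2) *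
      Real.exp (-(h n * A n) ^ 2) := by
    rw [← Real.exp_add]; congr 1; ring
  rw [e]; ring

/-- The central limit theorem under mod-Gaussian convergence. -/
theorem IsModGaussian.tendsto_measureReal_Ici (hMG : IsModGaussian P A κ)
    (hA : Tendsto A atTop atTop) {y : ℕ → ℝ} {y₀ : ℝ} (hy : Tendsto y atTop (𝓝 y₀)) :
    Tendsto (fun n => (P n).real (Set.Ici (A n * y n))) atTop
      (𝓝 ((gaussianReal (-y₀) 1).real (Set.Ici 0))) := by
  -- Subtracting `y n` fixes the threshold at `0`; the limit law is then shifted to mean `-y₀`.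
  have hp : ∀ n, IsProbabilityMeasure ((P n).map fun x => x / A n - y n) := fun n =>
    Measure.isProbabilityMeasure_map (by fun_prop)
  set μ : ℕ → ProbabilityMeasure ℝ := fun n => ⟨_, hp n⟩ with hμ
  set μ₀ : ProbabilityMeasure ℝ := ⟨gaussianReal (-y₀) 1, inferInstance⟩ with hμ₀
  have hAinv : Tendsto (fun n => (A n)⁻¹) atTop (𝓝 0) := tendsto_inv_atTop_zero.comp hA
  have hlim : Tendsto μ atTop (𝓝 μ₀) := by
    refine ProbabilityMeasure.tendsto_of_tendsto_charFun fun ξ => ?_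
    have h1 : Tendsto (fun n => residue P A κ n (((A n)⁻¹ : ℝ) * (ξ * Complex.I))) atTop (𝓝 1) := by
      refine hMG.tendsto_residue (R := 1) ?_
      have h2 : Tendsto (fun n => |(A n)⁻¹| * |ξ|) atTop (𝓝 (|0| * |ξ|)) :=
        hAinv.abs.mul_const _
      rw [abs_zero, zero_mul] at h2
      filter_upwards [h2.eventually_le_const zero_lt_one] with n hn
      simpa using hn
    have h3 : Tendsto (fun n => Complex.exp (-(ξ ^ 2 / 2) - κ * (((A n)⁻¹ : ℝ) * ξ) ^ 4 / 12
        - y n * ξ * Complex.I)) atTop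
        (𝓝 (Complex.exp (-(ξ ^ 2 / 2) - κ * ((0 : ℝ) * ξ) ^ 4 / 12 - y₀ * ξ * Complex.I))) := by
      have c1 := (Complex.continuous_ofReal.tendsto _).comp hAinv
      have c2 := (Complex.continuous_ofReal.tendsto _).comp hy
      exact (Complex.continuous_exp.tendsto _).comp
        (((((c1.mul_const (ξ : ℂ)).pow 4).const_mul (κ : ℂ)).div_const 12).const_sub _ |>.sub
          ((c2.mul_const (ξ : ℂ)).mul_const Complex.I))
    have h4 := h1.mul h3
    simp only [hμ, hμ₀, ProbabilityMeasure.coe_mk]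
    rw [charFun_gaussianReal]
    have e0 : Complex.exp (ξ * (-y₀ : ℝ) * Complex.I - (1 : NNReal) * ξ ^ 2 / 2)
        = 1 * Complex.exp (-(ξ ^ 2 / 2) - κ * ((0 : ℝ) * ξ) ^ 4 / 12 - y₀ * ξ * Complex.I) := by
      rw [one_mul]; congr 1; push_cast; ring
    rw [e0]
    refine h4.congr' ?_
    filter_upwards [hA.eventually_gt_atTop 0] with n hn
    have hn' : (A n : ℂ) ≠ 0 := by exact_mod_cast hn.ne'
    rw [charFun_apply_real, integral_map (by fun_prop)
      (Continuous.aestronglyMeasurable (by fun_prop))]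
    have e1 : ∀ x : ℝ, Complex.exp (ξ * (x / A n - y n : ℝ) * Complex.I)
        = Complex.exp (-(y n * ξ * Complex.I)) *
          Complex.exp ((((A n)⁻¹ : ℝ) * (ξ * Complex.I)) * (id x : ℝ)) := fun x => by
      rw [← Complex.exp_add]; congr 1; simp only [id]; push_cast; field_simp; ring
    simp_rw [e1]
    rw [integral_const_mul, ← complexMGF, complexMGF_eq_residue_mul (A := A) (κ := κ),
      mul_comm (Complex.exp (-(y n * ξ * Complex.I))), mul_assoc (residue _ _ _ _ _),
      ← Complex.exp_add]
    congr 2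
    push_cast
    have hI := Complex.I_sq
    have hI4 : Complex.I ^ 4 = 1 := Complex.I_pow_four
    simp only [mul_pow, hI4, hI]
    field_simp
    ring
  have hfr : μ₀ (frontier (Set.Ici 0)) = 0 := by
    have : NullSingletonClass (gaussianReal (-y₀) 1) := nullSingletonClass_gaussianReal one_ne_zero
    rw [frontier_Ici]
    rw [ProbabilityMeasure.null_iff_toMeasure_null]
    exact measure_singleton (μ := gaussianReal (-y₀) 1) 0
  have h1 := ProbabilityMeasure.tendsto_measure_of_null_frontier_of_tendsto hlim hfr
  have h2 := (NNReal.continuous_coe.tendsto _).comp h1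
  refine h2.congr' ?_
  filter_upwards [hA.eventually_gt_atTop 0] with n hn
  change ((P n).map fun x => x / A n - y n).real (Set.Ici 0) = _
  rw [map_measureReal_apply (by fun_prop) measurableSet_Ici]
  congr 1; ext x
  simp only [Set.mem_preimage, Set.mem_Ici, sub_nonneg, le_div_iff₀ hn]
  rw [mul_comm]

/-- Chernoff's bound with parameter `-1 / A n`, at which the moment generating function stays
bounded, makes the complement `O(exp (y n))`. -/
theorem IsModGaussian.tendsto_measureReal_Ici_one (hMG : IsModGaussian P A κ)
    (hi : ∀ n t, Integrable (fun x => Real.exp (t * x)) (P n))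
    (hA : Tendsto A atTop atTop) {y : ℕ → ℝ} (hy : Tendsto y atTop atBot) :
    Tendsto (fun n => (P n).real (Set.Ici (A n * y n))) atTop (𝓝 1) := by
  have hAinv : Tendsto (fun n => (A n)⁻¹) atTop (𝓝 0) := tendsto_inv_atTop_zero.comp hA
  have h1 : ∀ᶠ n in atTop, mgf id (P n) (-(A n)⁻¹) ≤
      2 * Real.exp (1 / 2 + |κ| / 12) := by
    have h2 : ∀ᶠ n in atTop, (A n)⁻¹ ≤ 1 := hAinv.eventually_le_const zero_lt_one
    filter_upwards [hMG 1 1 one_pos, h2, hA.eventually_gt_atTop 0] with n hn hn2 hpos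
    have hinv : 0 < (A n)⁻¹ := by positivity
    have h3 := hn ((-(A n)⁻¹ : ℝ) : ℂ) (by
      rw [Complex.norm_real, Real.norm_eq_abs, abs_neg, abs_of_pos hinv]; exact hn2)
    have h4 : ‖residue P A κ n ((-(A n)⁻¹ : ℝ) : ℂ)‖ ≤ 2 := by
      have := norm_le_norm_add_norm_sub' (residue P A κ n ((-(A n)⁻¹ : ℝ) : ℂ)) 1
      rw [norm_one] at this
      rw [residue] at this ⊢
      linarith
    have h5 : mgf id (P n) (-(A n)⁻¹) = ‖complexMGF id (P n) ((-(A n)⁻¹ : ℝ) : ℂ)‖ := by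
      rw [complexMGF_ofReal, Complex.norm_real, Real.norm_eq_abs, abs_of_nonneg mgf_nonneg]
    rw [h5, complexMGF_eq_residue_mul (A := A) (κ := κ), norm_mul]
    refine mul_le_mul h4 ?_ (norm_nonneg _) zero_le_two
    rw [Complex.norm_exp, Real.exp_le_exp]
    have h6 : (A n : ℂ) ^ 2 * ((-(A n)⁻¹ : ℝ) : ℂ) ^ 2 / 2 - κ * ((-(A n)⁻¹ : ℝ) : ℂ) ^ 4 / 12
        = ((1 / 2 - κ * (A n)⁻¹ ^ 4 / 12 : ℝ) : ℂ) := by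
      have hn' : (A n : ℂ) ≠ 0 := by exact_mod_cast hpos.ne'
      push_cast; field_simp
    rw [h6, Complex.ofReal_re]
    have h7 : (A n)⁻¹ ^ 4 ≤ 1 := pow_le_one₀ hinv.le hn2
    have h8 : 0 ≤ (A n)⁻¹ ^ 4 := by positivity
    have h9 := neg_abs_le κ
    have h10 := abs_nonneg κ
    nlinarith
  have h2 : ∀ᶠ n in atTop, 1 - Real.exp (y n) * (2 * Real.exp (1 / 2 + |κ| / 12)) ≤
      (P n).real (Set.Ici (A n * y n)) := by
    filter_upwards [h1, hA.eventually_gt_atTop 0] with n hn hpos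
    have h3 := measure_le_le_exp_mul_mgf (μ := P n) (X := id) (t := -(A n)⁻¹) (A n * y n)
      (by simpa using hpos.le) (hi n _)
    have h4 : (P n).real (Set.Ici (A n * y n))ᶜ ≤ (P n).real {ω | id ω ≤ A n * y n} := by
      refine measureReal_mono (fun x hx => ?_)
      simp only [Set.mem_compl_iff, Set.mem_Ici, not_le] at hx
      exact hx.le
    rw [probReal_compl_eq_one_sub measurableSet_Ici] at h4
    rw [neg_neg, inv_mul_cancel_left₀ hpos.ne'] at h3
    have := mul_le_mul_of_nonneg_left hn (Real.exp_pos (y n)).le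
    linarith
  have h3 : Tendsto (fun n => 1 - Real.exp (y n) * (2 * Real.exp (1 / 2 + |κ| / 12))) atTop
      (𝓝 (1 - 0 * (2 * Real.exp (1 / 2 + |κ| / 12)))) :=
    ((Real.tendsto_exp_atBot.comp hy).mul_const _).const_sub 1
  rw [zero_mul, sub_zero] at h3
  exact tendsto_of_tendsto_of_tendsto_of_le_of_le' h3 tendsto_const_nhds h2
    (Eventually.of_forall fun n => measureReal_le_one)

theorem IsModGaussian.tendsto_tail_of_isLittleO (hMG : IsModGaussian P A κ)
    (hi : ∀ n t, Integrable (fun x => Real.exp (t * x)) (P n))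
    (hA : Tendsto A atTop atTop) {y : ℕ → ℝ} (hyA : Tendsto (fun n => y n / A n) atTop (𝓝 0))
    (hy : Tendsto y atTop atTop) :
    Tendsto (fun n => y n * √(2 * Real.pi) * Real.exp (y n ^ 2 / 2) *
      (P n).real (Set.Ici (A n * y n))) atTop (𝓝 1) := by
  have e : (fun n => y n / A n * A n) =ᶠ[atTop] y := by
    filter_upwards [hA.eventually_gt_atTop 0] with n hn
    exact div_mul_cancel₀ _ hn.ne'
  have h1 := hMG.tendsto_tail hi (h := fun n => y n / A n)
    (by filter_upwards [hA.eventually_gt_atTop 0, hy.eventually_gt_atTop 0] with n h1 h2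
        positivity) hyA (hy.congr' e.symm)
  simp only [ne_eq, OfNat.ofNat_ne_zero, not_false_eq_true, zero_pow, mul_zero, zero_div, neg_zero,
    Real.exp_zero] at h1
  refine h1.congr' ?_
  filter_upwards [hA.eventually_gt_atTop 0] with n hn
  have e1 : y n / A n * A n = y n := div_mul_cancel₀ _ hn.ne'
  have e2 : A n ^ 2 * (y n / A n) = A n * y n := by field_simp
  rw [e1, e2]

/-- Lets every tail estimate be applied to the Gaussian law as well, so that the ratio in
`IsModGaussian.tendsto_ratio` needs no separate Gaussian asymptotics. -/
theorem isModGaussian_centeredGaussian (A : ℕ → ℝ) :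
    IsModGaussian (fun n => centeredGaussian (A n)) A 0 := by
  intro R ε hε
  refine Eventually.of_forall fun n z _ => ?_
  simp only [centeredGaussian]
  rw [complexMGF_id_gaussianReal, ← Complex.exp_add,
    Real.coe_toNNReal _ (sq_nonneg _)]
  push_cast
  ring_nf
  simp [hε.le]

theorem integrable_exp_centeredGaussian (s t : ℝ) :
    Integrable (fun x => Real.exp (t * x)) (centeredGaussian s) :=
  integrable_exp_mul_gaussianReal t

theorem gaussianReal_Ici_pos (y : ℝ) : 0 < (gaussianReal (-y) 1).real (Set.Ici 0) := by
  rw [measureReal_def, gaussianReal_apply_eq_integral _ one_ne_zero, ENNReal.toReal_ofReal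
    (integral_nonneg fun x => gaussianPDFReal_nonneg _ _ _)]
  rw [setIntegral_pos_iff_support_of_nonneg_ae
    (Eventually.of_forall fun x => gaussianPDFReal_nonneg _ _ _)
    (integrable_gaussianPDFReal _ _).integrableOn]
  have : Function.support (gaussianPDFReal (-y) 1) = Set.univ := by
    ext x; simp [(gaussianPDFReal_pos (-y) 1 x one_ne_zero).ne']
  rw [this]; simp

/-- The extended central limit theorem: the tail probabilities are equivalent to those of
Gaussian laws. -/
theorem IsModGaussian.tendsto_ratio (hMG : IsModGaussian P A κ)
    (hi : ∀ n t, Integrable (fun x => Real.exp (t * x)) (P n))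
    (hA : Tendsto A atTop atTop) {y : ℕ → ℝ} (hyA : Tendsto (fun n => y n / A n) atTop (𝓝 0)) :
    Tendsto (fun n => (P n).real (Set.Ici (A n * y n)) /
      (centeredGaussian (A n)).real (Set.Ici (A n * y n))) atTop (𝓝 1) := by
  refine tendsto_of_subseq_tendsto fun ns hns => ?_
  -- Compactness of the extended reals: some further subsequence of `y` converges to a real number
  -- or to `±∞`, and each case has its own limit theorem.
  obtain ⟨a, φ, hφ, hlim⟩ := CompactSpace.tendsto_subseq fun n => ((y (ns n) : ℝ) : EReal)
  have hψ : Tendsto (fun n => ns (φ n)) atTop atTop := hns.comp hφ.tendsto_atTop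
  refine ⟨φ, ?_⟩
  have m1 := hMG.comp hψ
  have m2 := (isModGaussian_centeredGaussian A).comp hψ
  have i1 : ∀ n t, Integrable (fun x => Real.exp (t * x)) ((P ∘ fun n => ns (φ n)) n) :=
    fun n t => hi _ t
  have i2 : ∀ n t, Integrable (fun x => Real.exp (t * x))
      (((fun n => centeredGaussian (A n)) ∘ fun n => ns (φ n)) n) :=
    fun n t => integrable_exp_centeredGaussian _ t
  have inst1 : ∀ n, IsProbabilityMeasure ((P ∘ fun n => ns (φ n)) n) := fun n => by
    simp only [Function.comp]; infer_instance
  have inst2 : ∀ n, IsProbabilityMeasure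
      (((fun n => centeredGaussian (A n)) ∘ fun n => ns (φ n)) n) := fun n => by
    simp only [Function.comp]; infer_instance
  have hA' : Tendsto (A ∘ fun n => ns (φ n)) atTop atTop := hA.comp hψ
  induction a with
  | bot =>
    have hy : Tendsto (fun n => y (ns (φ n))) atTop atBot := EReal.tendsto_coe_nhds_bot_iff.1 hlim
    have h1 := (m1.tendsto_measureReal_Ici_one i1 hA' hy).div
      (m2.tendsto_measureReal_Ici_one i2 hA' hy) one_ne_zero
    rw [div_one] at h1
    exact h1
  | coe y₀ =>
    have hy : Tendsto (fun n => y (ns (φ n))) atTop (𝓝 y₀) := EReal.tendsto_coe.1 hlim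
    have h1 := (m1.tendsto_measureReal_Ici hA' hy).div
      (m2.tendsto_measureReal_Ici hA' hy) (gaussianReal_Ici_pos y₀).ne'
    rw [div_self (gaussianReal_Ici_pos y₀).ne'] at h1
    exact h1
  | top =>
    have hy : Tendsto (fun n => y (ns (φ n))) atTop atTop := EReal.tendsto_coe_nhds_top_iff.1 hlim
    have h1 := (m1.tendsto_tail_of_isLittleO i1 hA' (hyA.comp hψ) hy).div
      (m2.tendsto_tail_of_isLittleO i2 hA' (hyA.comp hψ) hy) one_ne_zero
    rw [div_one] at h1
    refine h1.congr' ?_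
    filter_upwards [hy.eventually_gt_atTop 0] with n hn
    simp only [Pi.div_apply, Function.comp]
    rw [mul_div_mul_left _ _ (by positivity)]

theorem centeredGaussian_Ici {s : ℝ} (hs : 0 < s) (y : ℝ) :
    (centeredGaussian s).real (Set.Ici (s * y))
      = 1 / √(2 * Real.pi) * ∫ u in Set.Ioi y, Real.exp (-(u ^ 2 / 2)) := by
  have h1 : centeredGaussian s = (gaussianReal 0 1).map (s * ·) := by
    rw [gaussianReal_map_const_mul, centeredGaussian, mul_zero, mul_one]
    congr 1
    exact Real.toNNReal_of_nonneg (sq_nonneg s)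
  rw [h1, map_measureReal_apply (by fun_prop) measurableSet_Ici]
  have h2 : (fun x => s * x) ⁻¹' Set.Ici (s * y) = Set.Ici y := by
    ext x; simp [mul_le_mul_iff_right₀ hs]
  rw [h2, measureReal_def, gaussianReal_apply_eq_integral _ one_ne_zero, ENNReal.toReal_ofReal
    (integral_nonneg fun x => gaussianPDFReal_nonneg _ _ _), integral_Ici_eq_integral_Ioi,
    ← integral_const_mul]
  congr 1; ext u
  rw [gaussianPDFReal_def]
  simp only [NNReal.coe_one, mul_one, sub_zero, one_div]
  congr 2; ring

end ModGaussian

/-! ### Application to lacunary Walsh sums -/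

theorem sum_Icc_one_eq_sum_range {M : Type*} [AddCommMonoid M] (f : ℕ → M) (n : ℕ) :
    ∑ k ∈ Finset.Icc 1 n, f k = ∑ k ∈ Finset.range n, f (k + 1) := by
  induction n with
  | zero => simp
  | succ n ih => rw [Finset.sum_Icc_succ_top (by omega), ih, Finset.sum_range_succ]

theorem abs_le_rowMax (a : ℕ → ℕ → ℝ) {n k : ℕ} (hk : k ∈ Finset.Icc 1 n) :
    |a k n| ≤ rowMax a n := by
  have h := Finset.le_sup (f := fun k => ‖a k n‖₊) hk
  exact_mod_cast h

theorem rowMax_nonneg (a : ℕ → ℕ → ℝ) (n : ℕ) : 0 ≤ rowMax a n := NNReal.coe_nonneg _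

theorem rowMax_neg (a : ℕ → ℕ → ℝ) : rowMax (fun k n => -a k n) = rowMax a := by
  ext n; simp [rowMax]

theorem rowNorm_neg (a : ℕ → ℕ → ℝ) : rowNorm (fun k n => -a k n) = rowNorm a := by
  ext n; simp [rowNorm]

theorem walshSum_neg (a : ℕ → ℕ → ℝ) (m : ℕ → ℕ) (n : ℕ) (x : ℝ) :
    walshSum (fun k n => -a k n) m n x = -walshSum a m n x := by
  simp [walshSum]

theorem measurable_walshSum (a : ℕ → ℕ → ℝ) (m : ℕ → ℕ) (n : ℕ) : Measurable (walshSum a m n) := by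
  unfold walshSum
  exact Finset.measurable_sum _ fun k _ => (measurable_walsh _).const_mul _

theorem sq_rowNorm (a : ℕ → ℕ → ℝ) (n : ℕ) :
    rowNorm a n ^ 2 = ∑ k ∈ Finset.Icc 1 n, a k n ^ 2 :=
  Real.sq_sqrt (Finset.sum_nonneg fun _ _ => sq_nonneg _)

/-- The law of the Walsh sum. -/
noncomputable def walshLaw (a : ℕ → ℕ → ℝ) (m : ℕ → ℕ) (n : ℕ) : Measure ℝ :=
  unitMeasure.map (walshSum a m n)

instance (a : ℕ → ℕ → ℝ) (m : ℕ → ℕ) (n : ℕ) : IsProbabilityMeasure (walshLaw a m n) :=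
  Measure.isProbabilityMeasure_map (measurable_walshSum a m n).aemeasurable

theorem integrable_exp_walshLaw (a : ℕ → ℕ → ℝ) (m : ℕ → ℕ) (n : ℕ) (t : ℝ) :
    Integrable (fun x => Real.exp (t * x)) (walshLaw a m n) := by
  rw [walshLaw, integrable_map_measure (Continuous.aestronglyMeasurable (by fun_prop))
    (measurable_walshSum a m n).aemeasurable]
  refine Integrable.of_bound (C := Real.exp (|t| * ∑ k ∈ Finset.Icc 1 n, |a k n|)) ?_
    (Eventually.of_forall fun x => ?_)
  · exact (Real.measurable_exp.comp
      ((measurable_walshSum a m n).const_mul t)).aestronglyMeasurable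
  · simp only [Function.comp, Real.norm_eq_abs, Real.abs_exp, Real.exp_le_exp]
    refine (le_abs_self _).trans ?_
    rw [abs_mul]
    refine mul_le_mul_of_nonneg_left ((Finset.abs_sum_le_sum_abs _ _).trans ?_) (abs_nonneg t)
    refine Finset.sum_le_sum fun k _ => ?_
    rw [abs_mul, abs_walsh, mul_one]

theorem isModGaussian_walshLaw {q κ₄ : ℝ} {m : ℕ → ℕ} {a : ℕ → ℕ → ℝ} (hm : IsLacunary q m)
    (hq_ge : 2 ≤ q →
      Tendsto (fun n : ℕ => ∑ k ∈ Finset.Icc 1 n, a k n ^ 4) atTop (𝓝 κ₄) ∧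
      Tendsto (fun n : ℕ => (n : ℝ) * rowMax a n ^ 5) atTop (𝓝 0))
    (hq_lt : q < 2 → ∃ ε : ℝ, 0 < ε ∧
      Tendsto (fun n : ℕ => (n : ℝ) ^ (1 + ε) * rowMax a n ^ 3) atTop (𝓝 0)) :
    IsModGaussian (walshLaw a m) (rowNorm a) (if 2 ≤ q then κ₄ else 0) := by
  obtain ⟨hq, hm⟩ := hm
  set m' : ℕ → ℕ := fun k => m (k + 1) with hm'
  -- Coefficients are reindexed from `0` and set to `0` beyond the row, so that the bound by
  -- `rowMax` holds for every `k`.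
  set b : ℕ → ℕ → ℝ := fun n k => if k < n then a (k + 1) n else 0 with hb
  have h0 : ∀ k, 0 < m' k := fun k => (hm (k + 1) (by omega)).1
  have hr : ∀ k, q * m' k ≤ m' (k + 1) := fun k => by
    have := (hm (k + 1) (by omega)).2
    rwa [le_div_iff₀ (by exact_mod_cast h0 k)] at this
  have hbr : ∀ n, ∀ k ∈ Finset.range n, b n k = a (k + 1) n := fun n k hk => by
    simp [hb, Finset.mem_range.1 hk]
  have hlaw : walshLaw a m =
      fun n => unitMeasure.map fun x => ∑ k ∈ Finset.range n, b n k * walsh (m' k) x := by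
    ext1 n
    rw [walshLaw]
    congr 1; ext x
    rw [walshSum, sum_Icc_one_eq_sum_range]
    exact Finset.sum_congr rfl fun k hk => by rw [hbr n k hk]
  have hpow : ∀ n i, ∑ k ∈ Finset.range n, b n k ^ i = ∑ k ∈ Finset.Icc 1 n, a k n ^ i := by
    intro n i
    rw [sum_Icc_one_eq_sum_range]
    exact Finset.sum_congr rfl fun k hk => by rw [hbr n k hk]
  have hbd : ∀ n k, |b n k| ≤ rowMax a n := fun n k => by
    simp only [hb]
    split_ifs with h
    · exact abs_le_rowMax a (by simp; omega)
    · simpa using rowMax_nonneg a n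
  have hA : ∀ n, rowNorm a n ^ 2 = ∑ k ∈ Finset.range n, b n k ^ 2 := fun n => by
    rw [hpow, sq_rowNorm]
  have hd : ∀ i : ℕ, i ≠ 0 → Tendsto (fun n : ℕ => (n : ℝ) * rowMax a n ^ i) atTop (𝓝 0) →
      Tendsto (rowMax a) atTop (𝓝 0) := by
    intro i hi h
    have h1 : Tendsto (fun n => rowMax a n ^ i) atTop (𝓝 0) := by
      refine squeeze_zero' (Eventually.of_forall fun n => pow_nonneg (rowMax_nonneg a n) i) ?_ h
      filter_upwards [eventually_ge_atTop 1] with n hn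
      have : (1 : ℝ) ≤ n := by exact_mod_cast hn
      exact le_mul_of_one_le_left (pow_nonneg (rowMax_nonneg a n) i) this
    have h2 := h1.rpow_const (p := (i : ℝ)⁻¹) (Or.inr (by positivity))
    rw [Real.zero_rpow (by positivity)] at h2
    refine h2.congr fun n => ?_
    exact Real.pow_rpow_inv_natCast (rowMax_nonneg a n) hi
  rw [hlaw]
  by_cases h2 : 2 ≤ q
  · rw [if_pos h2]
    obtain ⟨hκ, h5⟩ := hq_ge h2
    refine isModGaussian_of_tendsto m' b hA hbd (hd 5 (by norm_num) h5) ?_ fun R _ => ?_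
    · simpa only [hpow] using hκ
    · exact ⟨fun _ => 1, tendsto_const_nhds, fun n _ x hx _ =>
        (xorSum_zero_eq_one h2 h0 hr hx n).le⟩
  · rw [if_neg h2]
    obtain ⟨ε, hε, h3⟩ := hq_lt (not_le.1 h2)
    have h3' : Tendsto (fun n : ℕ => (n : ℝ) * rowMax a n ^ 3) atTop (𝓝 0) := by
      refine squeeze_zero' (Eventually.of_forall fun n =>
        mul_nonneg (Nat.cast_nonneg n) (pow_nonneg (rowMax_nonneg a n) 3)) ?_ h3
      filter_upwards [eventually_ge_atTop 1] with n hn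
      have h1 : (1 : ℝ) ≤ n := by exact_mod_cast hn
      refine mul_le_mul_of_nonneg_right ?_ (pow_nonneg (rowMax_nonneg a n) 3)
      calc (n : ℝ) = (n : ℝ) ^ (1 : ℝ) := (Real.rpow_one _).symm
        _ ≤ _ := Real.rpow_le_rpow_of_exponent_le h1 (by linarith)
    have hd0 := hd 3 (by norm_num) h3'
    refine isModGaussian_of_tendsto m' b hA hbd hd0 ?_ fun R hR => ?_
    -- For `q < 2` the fourth powers sum to at most `n d_n⁴ = (n d_n³) d_n → 0`, hence `κ = 0`.
    · have h4 := h3'.mul hd0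
      rw [zero_mul] at h4
      refine squeeze_zero (fun n => Finset.sum_nonneg fun k _ => by positivity) (fun n => ?_) h4
      calc ∑ k ∈ Finset.range n, b n k ^ 4 ≤ ∑ k ∈ Finset.range n, rowMax a n ^ 4 := by
            refine Finset.sum_le_sum fun k _ => ?_
            rw [← Even.pow_abs (by decide : Even 4)]
            exact pow_le_pow_left₀ (abs_nonneg _) (hbd n k) 4
        _ = _ := by rw [Finset.sum_const, Finset.card_range, nsmul_eq_mul]; ring
    · obtain ⟨K, hK, hle⟩ := xorSum_zero_le hq
      refine ⟨fun n => Real.exp (K * (n * (R * rowMax a n) ^ 3)), ?_, fun n hn x hx hxd =>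
        hle m' h0 hr x hx _ hxd hn n⟩
      have h4 : Tendsto (fun n : ℕ => Real.exp (K * R ^ 3 * ((n : ℝ) * rowMax a n ^ 3))) atTop
          (𝓝 (Real.exp (K * R ^ 3 * 0))) :=
        (Real.continuous_exp.tendsto _).comp (h3'.const_mul _)
      rw [mul_zero, Real.exp_zero] at h4
      refine h4.congr fun n => ?_
      congr 1; ring

theorem volume_walshSum_eq (a : ℕ → ℕ → ℝ) (m : ℕ → ℕ) (n : ℕ) (c : ℝ) :
    volume.real {x : ℝ | x ∈ Set.Icc (0 : ℝ) 1 ∧ c ≤ walshSum a m n x}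
      = (walshLaw a m n).real (Set.Ici c) := by
  rw [walshLaw, map_measureReal_apply (measurable_walshSum a m n) measurableSet_Ici, unitMeasure,
    measureReal_restrict_apply (measurable_walshSum a m n measurableSet_Ici)]
  congr 1; ext x
  simp [and_comm]

theorem isEquivalent_tail {q κ₄ : ℝ} {m : ℕ → ℕ} {a : ℕ → ℕ → ℝ}
    (hMG : IsModGaussian (walshLaw a m) (rowNorm a) (if 2 ≤ q then κ₄ else 0))
    (hA : Tendsto (rowNorm a) atTop atTop) {y : ℝ} (hy : 0 < y) :
    (fun n : ℕ => volume.real {x : ℝ | x ∈ Set.Icc (0 : ℝ) 1 ∧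
          rowNorm a n ^ 2 * y ≤ walshSum a m n x})
        ~[atTop]
      (fun n : ℕ => Real.exp (-(rowNorm a n ^ 2 * (y ^ 2 / 2))) /
          (y * rowNorm a n * √(2 * Real.pi)) * limitFun q κ₄ y) := by
  have h1 := hMG.tendsto_tail (integrable_exp_walshLaw a m) (h := fun _ => y)
    (Eventually.of_forall fun _ => hy) tendsto_const_nhds (hA.const_mul_atTop hy)
  have hψ : Real.exp (-((if 2 ≤ q then κ₄ else 0) * y ^ 4 / 12)) = limitFun q κ₄ y := by
    rw [limitFun]
    split_ifs
    · congr 1; ring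
    · simp
  have hψ0 : limitFun q κ₄ y ≠ 0 := by rw [← hψ]; positivity
  rw [hψ] at h1
  have h2 := h1.div_const (limitFun q κ₄ y)
  rw [div_self hψ0] at h2
  refine isEquivalent_of_tendsto_one (h2.congr' ?_)
  filter_upwards [hA.eventually_gt_atTop 0] with n hn
  simp only [Pi.div_apply]
  rw [volume_walshSum_eq, show rowNorm a n ^ 2 * (y ^ 2 / 2) = (y * rowNorm a n) ^ 2 / 2 by ring,
    Real.exp_neg]
  have hs : 0 < √(2 * Real.pi) := by positivity
  have he := Real.exp_pos ((y * rowNorm a n) ^ 2 / 2)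
  field_simp

end LacunaryWalsh
theorem mainTheorem6 (q κ₄ : ℝ) (m : ℕ → ℕ) (a : ℕ → ℕ → ℝ)
    (hm : LacunaryWalsh.IsLacunary q m)
    (hA : Tendsto (LacunaryWalsh.rowNorm a) atTop atTop)
    (hq_ge : 2 ≤ q →
      Tendsto (fun n : ℕ => ∑ k ∈ Finset.Icc 1 n, a k n ^ 4) atTop (𝓝 κ₄) ∧
      Tendsto (fun n : ℕ => (n : ℝ) * LacunaryWalsh.rowMax a n ^ 5) atTop (𝓝 0))
    (hq_lt : q < 2 → ∃ ε : ℝ, 0 < ε ∧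
      Tendsto (fun n : ℕ => (n : ℝ) ^ (1 + ε) * LacunaryWalsh.rowMax a n ^ 3) atTop (𝓝 0)) :
    -- extended central limit theorem
    (∀ y : ℕ → ℝ, y =o[atTop] LacunaryWalsh.rowNorm a →
      (fun n : ℕ => volume.real {x : ℝ | x ∈ Set.Icc (0 : ℝ) 1 ∧
          y n ≤ LacunaryWalsh.walshSum a m n x / LacunaryWalsh.rowNorm a n})
        ~[atTop]
      (fun n : ℕ => 1 / √(2 * Real.pi) * ∫ u in Set.Ioi (y n), Real.exp (-(u ^ 2 / 2)))) ∧
    (∀ y : ℕ → ℝ, y =o[atTop] LacunaryWalsh.rowNorm a → Tendsto y atTop atTop →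
      (fun n : ℕ => volume.real {x : ℝ | x ∈ Set.Icc (0 : ℝ) 1 ∧
          y n ≤ LacunaryWalsh.walshSum a m n x / LacunaryWalsh.rowNorm a n})
        ~[atTop]
      (fun n : ℕ => Real.exp (-(y n ^ 2 / 2)) / (y n * √(2 * Real.pi)))) ∧
    -- moderate deviations
    (∀ y : ℝ, 0 < y →
      (fun n : ℕ => volume.real {x : ℝ | x ∈ Set.Icc (0 : ℝ) 1 ∧
          LacunaryWalsh.rowNorm a n ^ 2 * y ≤ LacunaryWalsh.walshSum a m n x})
        ~[atTop]
      (fun n : ℕ => Real.exp (-(LacunaryWalsh.rowNorm a n ^ 2 * (y ^ 2 / 2))) /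
          (y * LacunaryWalsh.rowNorm a n * √(2 * Real.pi)) * LacunaryWalsh.limitFun q κ₄ y)) ∧
    (∀ y : ℝ, y < 0 →
      (fun n : ℕ => volume.real {x : ℝ | x ∈ Set.Icc (0 : ℝ) 1 ∧
          LacunaryWalsh.walshSum a m n x ≤ LacunaryWalsh.rowNorm a n ^ 2 * y})
        ~[atTop]
      (fun n : ℕ => Real.exp (-(LacunaryWalsh.rowNorm a n ^ 2 * (y ^ 2 / 2))) /
          (|y| * LacunaryWalsh.rowNorm a n * √(2 * Real.pi)) * LacunaryWalsh.limitFun q κ₄ y)) := by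
  have hMG := LacunaryWalsh.isModGaussian_walshLaw hm hq_ge hq_lt
  have hset : ∀ y : ℕ → ℝ, ∀ᶠ n in atTop, volume.real {x : ℝ | x ∈ Set.Icc (0 : ℝ) 1 ∧
      y n ≤ LacunaryWalsh.walshSum a m n x / LacunaryWalsh.rowNorm a n}
      = (LacunaryWalsh.walshLaw a m n).real (Set.Ici (LacunaryWalsh.rowNorm a n * y n)) := by
    intro y
    filter_upwards [hA.eventually_gt_atTop 0] with n hn
    rw [← LacunaryWalsh.volume_walshSum_eq]
    simp only [le_div_iff₀ hn, mul_comm (y n)]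
  refine ⟨fun y hy => ?_, fun y hy hy' => ?_, fun y hy => ?_, fun y hy => ?_⟩
  · have h1 := hMG.tendsto_ratio (LacunaryWalsh.integrable_exp_walshLaw a m) hA hy.tendsto_div_nhds_zero
    refine isEquivalent_of_tendsto_one (h1.congr' ?_)
    filter_upwards [hset y, hA.eventually_gt_atTop 0] with n h2 hn
    rw [Pi.div_apply, h2, LacunaryWalsh.centeredGaussian_Ici hn]
  · have h1 := hMG.tendsto_tail_of_isLittleO (LacunaryWalsh.integrable_exp_walshLaw a m) hA
      hy.tendsto_div_nhds_zero hy'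
    refine isEquivalent_of_tendsto_one (h1.congr' ?_)
    filter_upwards [hset y, hy'.eventually_gt_atTop 0] with n h2 hn
    rw [Pi.div_apply, h2, Real.exp_neg]
    have hs : 0 < √(2 * Real.pi) := by positivity
    have he := Real.exp_pos (y n ^ 2 / 2)
    field_simp
  · exact LacunaryWalsh.isEquivalent_tail hMG hA hy
  -- The lower tail is the upper tail for the array `-a`; the norms, maxima and fourth powers are
  -- unchanged by the sign.
  · have hMG' := LacunaryWalsh.isModGaussian_walshLaw (a := fun k n => -a k n) (κ₄ := κ₄) hm
      (by simpa [LacunaryWalsh.rowMax_neg, Even.neg_pow (by decide : Even 4)] using hq_ge)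
      (by simpa [LacunaryWalsh.rowMax_neg] using hq_lt)
    have h1 := LacunaryWalsh.isEquivalent_tail hMG' (by rwa [LacunaryWalsh.rowNorm_neg])
      (neg_pos.2 hy)
    simp only [LacunaryWalsh.rowNorm_neg, LacunaryWalsh.walshSum_neg, mul_neg, neg_le_neg_iff] at h1
    have e : LacunaryWalsh.limitFun q κ₄ (-y) = LacunaryWalsh.limitFun q κ₄ y := by
      simp [LacunaryWalsh.limitFun, Even.neg_pow (by decide : Even 4)]
    rw [abs_of_neg hy]
    rw [e, neg_sq] at h1
    exact h1
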